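/- **Setting.** Let $(\overline M^{\,n+2},\overline g)$ be a Lorentzian manifold with Levi-Civita connection $\overline\nabla$, and let $M^{n+1}$ be an (immersed) lightlike hypersurface of it: the induced metric $g=\langle\cdot,\cdot\rangle$ is degenerate with radical $RadTM=TM\cap TM^{\perp}$ of rank one. Assume that $M$ is totally geodesic ($\overline\nabla_XY$ is tangent to $M$ for all $X,Y$ tangent to $M$). Let $S(TM)$ be a screen distribution, i.e. a smooth distribution with $TM=S(TM)\oplus RadTM$, let $\xi$ be a nowhere vanishing smooth section of $RadTM$ on $M$, and let $N$ be the unique section of $T\overline M|_M$ with $\overline g(N,\xi)=1$, $\overline g(N,N)=0$ and $\overline g(N,W)=0$ for all $W\in S(TM)$. Put $\eta=\overline g(N,\cdot)$ and $PX=X-\eta(X)\xi$ (the projection of $TM$ onto $S(TM)$), and let $\nabla$ be the induced connection, i.e. $\nabla_XY$ is the $TM$-component of $\overline\nabla_XY$ in $T\overline M|_M=TM\oplus \mathrm{span}(N)$. Put $X^\flat(Y)=\langle X,Y\rangle+\eta(X)\eta(Y)$ and $C(X,PY)=\eta(\nabla_XPY)$; for a smooth function $\lambda$ on $M$ the gradient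 $\nabla^g\lambda$ is the vector field with $(\nabla^g\lambda)^\flat=d\lambda$. An *$\mathcal A^\nabla$-tensor* is a smooth field $S$ of endomorphisms of $TM$ with $SP=PS$, $\langle SX,Y\rangle=\langle X,SY\rangle$ and $X^\flat(\nabla S(X,X))=0$ for all $X,Y\in TM$, where $\nabla S(X,Y)=\nabla_X(SY)-S(\nabla_XY)$. Its *eigenfunctions* are smooth functions $\lambda_0,\dots,\lambda_k$ on $M$ whose values at each point are pairwise distinct and are exactly the eigenvalues of $S$ at that point, numbered so that $D_0=RadTM$, where $D_\alpha=\ker(\lambda_\alpha I-S)$. The $D_\alpha$ form an *integrable almost product structure* if every sum $D_{\alpha_1}\oplus\dots\oplus D_{\alpha_p}$ is integrable, i.e. closed under the Lie bracket of its smooth local sections. **Theorem 7.1.** Let $S$ be an $\mathcal A^\nabla$-tensor on $(M,g,S(TM))$ with eigenfunctions $\lambda_0,\dots,\lambda_k$. Assume that $\nabla^g\lambda_0,\dots,\nabla^g\lambda_k$ are all $RadTM$-valued and that $D_0,\dots,D_k$ form an integrable almost product structure on $M$. Then $\nabla S(X,Y)\in D_0=RadTM$ for all $X\in S(TM)$ and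 $Y\in TM$. More precisely, for $X\in S(TM)$ and $Y\in D_j$, $0\le j\le k$, $$\nabla S(X,Y)=(\lambda_j-\lambda_0)\,C(X,PY)\,\xi$$ (and $PY=Y$ if $j\ge 1$). -/

import Mathlib

open scoped Manifold ContDiff Topology Bundle

noncomputable section

namespace NullGeometry

/-- The vector field `X` is differentiable at the point `x`. -/
def DiffFieldAt {m : ℕ} {M : Type*} [TopologicalSpace M]
    [ChartedSpace (EuclideanSpace ℝ (Fin m)) M] [IsManifold (𝓡 m) ∞ M]
    (X : Π y : M, TangentSpace (𝓡 m) y) (x : M) : Prop :=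
  MDifferentiableAt (𝓡 m) (𝓡 m).tangent (fun y ↦ (⟨y, X y⟩ : TangentBundle (𝓡 m) M)) x

/-- The vector field `X` is smooth on the set `U`. -/
def SmoothFieldOn {m : ℕ} {M : Type*} [TopologicalSpace M]
    [ChartedSpace (EuclideanSpace ℝ (Fin m)) M] [IsManifold (𝓡 m) ∞ M]
    (X : Π y : M, TangentSpace (𝓡 m) y) (U : Set M) : Prop :=
  ContMDiffOn (𝓡 m) (𝓡 m).tangent ∞ (fun y ↦ (⟨y, X y⟩ : TangentBundle (𝓡 m) M)) U

/-- A Lorentzian metric: a smooth symmetric bilinear form on the tangent spaces of an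
`m`-dimensional manifold which at each point has the matrix `diag(-1, 1, …, 1)` in a suitable
basis (index one). -/
structure LorentzianMetric (m : ℕ) (N : Type*) [TopologicalSpace N]
    [ChartedSpace (EuclideanSpace ℝ (Fin m)) N] [IsManifold (𝓡 m) ∞ N] where
  val : ∀ p : N, TangentSpace (𝓡 m) p →L[ℝ] TangentSpace (𝓡 m) p →L[ℝ] ℝ
  contMDiff : ContMDiff (𝓡 m)
    ((𝓡 m).prod 𝓘(ℝ, EuclideanSpace ℝ (Fin m) →L[ℝ] EuclideanSpace ℝ (Fin m) →L[ℝ] ℝ)) ∞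
    (fun p : N ↦ Bundle.TotalSpace.mk'
      (EuclideanSpace ℝ (Fin m) →L[ℝ] EuclideanSpace ℝ (Fin m) →L[ℝ] ℝ)
      (E := fun p : N ↦ TangentSpace (𝓡 m) p →L[ℝ] TangentSpace (𝓡 m) p →L[ℝ] ℝ) p (val p))
  symm : ∀ (p : N) (v w : TangentSpace (𝓡 m) p), val p v w = val p w v
  lorentzian : ∀ p : N, ∃ b : Module.Basis (Fin m) ℝ (TangentSpace (𝓡 m) p),
    ∀ i j, val p (b i) (b j) = if i = j then (if (i : ℕ) = 0 then -1 else 1) else 0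

/-- `D` is a Levi-Civita connection of `gb`: it is torsion-free and
`X (gb (Y, Z)) = gb (D_X Y, Z) + gb (Y, D_X Z)`.  In Mathlib's argument order, `D_v Y` at the
point `p` is `D Y p v`. -/
structure IsLeviCivita {m : ℕ} {N : Type*} [TopologicalSpace N]
    [ChartedSpace (EuclideanSpace ℝ (Fin m)) N] [IsManifold (𝓡 m) ∞ N]
    (gb : LorentzianMetric m N)
    (D : CovariantDerivative (𝓡 m) (EuclideanSpace ℝ (Fin m))
      (TangentSpace (𝓡 m) : N → Type _)) : Prop where
  torsion_free : ∀ (p : N) (X Y : Π q : N, TangentSpace (𝓡 m) q),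
    DiffFieldAt X p → DiffFieldAt Y p →
      D Y p (X p) - D X p (Y p) = VectorField.mlieBracket (𝓡 m) X Y p
  metric : ∀ (p : N) (v : TangentSpace (𝓡 m) p) (Y Z : Π q : N, TangentSpace (𝓡 m) q),
    DiffFieldAt Y p → DiffFieldAt Z p →
      mvfderiv (𝓡 m) (fun q ↦ gb.val q (Y q) (Z q)) p v
        = gb.val p (D Y p v) (Z p) + gb.val p (Y p) (D Z p v)

section Intrinsic

variable {m : ℕ} {M : Type*} [TopologicalSpace M] [ChartedSpace (EuclideanSpace ℝ (Fin m)) M]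
  [IsManifold (𝓡 m) ∞ M]

/-- The family of subspaces `D` is smooth: every vector of `D` extends to a smooth local section
of `D`. -/
def IsSmoothDistribution (D : ∀ x : M, Submodule ℝ (TangentSpace (𝓡 m) x)) : Prop :=
  ∀ (x : M), ∀ v ∈ D x, ∃ (U : Set M) (X : Π y : M, TangentSpace (𝓡 m) y),
    IsOpen U ∧ x ∈ U ∧ SmoothFieldOn X U ∧ (∀ y ∈ U, X y ∈ D y) ∧ X x = v

/-- The distribution `D` is integrable: the bracket of two smooth local sections of `D` is again
a section of `D`. -/
def IsIntegrable (D : ∀ x : M, Submodule ℝ (TangentSpace (𝓡 m) x)) : Prop :=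
  ∀ (U : Set M) (X Y : Π y : M, TangentSpace (𝓡 m) y), IsOpen U →
    SmoothFieldOn X U → SmoothFieldOn Y U →
    (∀ y ∈ U, X y ∈ D y) → (∀ y ∈ U, Y y ∈ D y) →
    ∀ y ∈ U, VectorField.mlieBracket (𝓡 m) X Y y ∈ D y

/-- The eigendistribution `Ker (S - l)` of an endomorphism field `S` for a function `l`. -/
def eigenDist (S : ∀ x : M, TangentSpace (𝓡 m) x →L[ℝ] TangentSpace (𝓡 m) x) (l : M → ℝ)
    (x : M) : Submodule ℝ (TangentSpace (𝓡 m) x) :=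
  Module.End.eigenspace (S x).toLinearMap (l x)

/-- `(D 0, …, D k)` is an integrable almost product structure: the sum of any of these
distributions is integrable. -/
def IsIntegrableAlmostProduct {k : ℕ}
    (D : Fin (k + 1) → ∀ x : M, Submodule ℝ (TangentSpace (𝓡 m) x)) : Prop :=
  ∀ A : Finset (Fin (k + 1)), IsIntegrable (fun x ↦ ⨆ α ∈ A, D α x)

/-- `∇S (v, Y) = ∇_v (S Y) - S (∇_v Y)` at the point `x`.  At a point where `S` and `Y` are
differentiable it depends on `Y` only through the value `Y x`. -/
def covEnd
    (D : CovariantDerivative (𝓡 m) (EuclideanSpace ℝ (Fin m)) (TangentSpace (𝓡 m) : M → Type _))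
    (S : ∀ x : M, TangentSpace (𝓡 m) x →L[ℝ] TangentSpace (𝓡 m) x)
    (x : M) (v : TangentSpace (𝓡 m) x) (Y : Π y : M, TangentSpace (𝓡 m) y) :
    TangentSpace (𝓡 m) x :=
  D (fun y ↦ S y (Y y)) x v - S x (D Y x v)

end Intrinsic

section Hypersurface

variable {n : ℕ}
  {M : Type*} [TopologicalSpace M] [ChartedSpace (EuclideanSpace ℝ (Fin (n + 1))) M]
  [IsManifold (𝓡 (n + 1)) ∞ M]
  {N : Type*} [TopologicalSpace N] [ChartedSpace (EuclideanSpace ℝ (Fin (n + 2))) N]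
  [IsManifold (𝓡 (n + 2)) ∞ N]

/-- The push-forward of tangent vectors of the hypersurface. -/
def push (f : M → N) (x : M) :
    TangentSpace (𝓡 (n + 1)) x →L[ℝ] TangentSpace (𝓡 (n + 2)) (f x) :=
  mfderiv (𝓡 (n + 1)) (𝓡 (n + 2)) f x

/-- The induced (possibly degenerate) metric `g = ⟨·, ·⟩` on the hypersurface. -/
def indMetric (gb : LorentzianMetric (n + 2) N) (f : M → N) (x : M)
    (v w : TangentSpace (𝓡 (n + 1)) x) : ℝ :=
  gb.val (f x) (push f x v) (push f x w)

/-- The radical `Rad T_x M` of the induced metric, that is, `T_x M ∩ (T_x M)^⊥`. -/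
def radical (gb : LorentzianMetric (n + 2) N) (f : M → N) (x : M) :
    Submodule ℝ (TangentSpace (𝓡 (n + 1)) x) where
  carrier := {v | ∀ w, indMetric gb f x v w = 0}
  add_mem' := by
    intro a b ha hb w
    have h1 := ha w
    have h2 := hb w
    simp only [indMetric] at h1 h2 ⊢
    simp [h1, h2]
  zero_mem' := by
    intro w
    simp [indMetric]
  smul_mem' := by
    intro c a ha w
    have h1 := ha w
    simp only [indMetric] at h1 ⊢
    simp [h1]

/-- `f` is an immersed hypersurface on which the metric is degenerate with radical of rank one. -/
structure IsLightlikeHypersurface (gb : LorentzianMetric (n + 2) N) (f : M → N) : Prop where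
  immersion : Manifold.IsImmersion (𝓡 (n + 1)) (𝓡 (n + 2)) ∞ f
  rank_radical : ∀ x : M, Module.finrank ℝ (radical gb f x) = 1

/-- A screen distribution: a smooth distribution complementary to the radical in `TM`. -/
structure IsScreen (gb : LorentzianMetric (n + 2) N) (f : M → N)
    (sc : ∀ x : M, Submodule ℝ (TangentSpace (𝓡 (n + 1)) x)) : Prop where
  smooth : IsSmoothDistribution sc
  isCompl : ∀ x : M, IsCompl (radical gb f x) (sc x)

/-- A global nowhere vanishing smooth section `ξ` of the radical. -/
structure IsNullSection (gb : LorentzianMetric (n + 2) N) (f : M → N)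
    (ξ : Π x : M, TangentSpace (𝓡 (n + 1)) x) : Prop where
  smooth : SmoothFieldOn ξ Set.univ
  ne_zero : ∀ x : M, ξ x ≠ 0
  mem_radical : ∀ x : M, ξ x ∈ radical gb f x

/-- The null transversal field `ν` of the screen distribution `sc` normalized by `ξ`; it spans the
transversal line bundle `tr (TM)`. -/
structure IsNullTransversal (gb : LorentzianMetric (n + 2) N) (f : M → N)
    (sc : ∀ x : M, Submodule ℝ (TangentSpace (𝓡 (n + 1)) x))
    (ξ : Π x : M, TangentSpace (𝓡 (n + 1)) x)
    (ν : Π x : M, TangentSpace (𝓡 (n + 2)) (f x)) : Prop where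
  inner_xi : ∀ x : M, gb.val (f x) (ν x) (push f x (ξ x)) = 1
  null : ∀ x : M, gb.val (f x) (ν x) (ν x) = 0
  inner_screen : ∀ x : M, ∀ w ∈ sc x, gb.val (f x) (ν x) (push f x w) = 0

/-- Near `x`, the vector field `Yb` of the ambient space extends the push-forward of `Y`. -/
def IsExtensionAt (f : M → N) (x : M) (Y : Π y : M, TangentSpace (𝓡 (n + 1)) y)
    (Yb : Π q : N, TangentSpace (𝓡 (n + 2)) q) : Prop :=
  DiffFieldAt Y x ∧ DiffFieldAt Yb (f x) ∧ ∀ᶠ y in 𝓝 x, Yb (f y) = push f y (Y y)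

/-- The hypersurface is totally geodesic: the ambient covariant derivative of a tangent field in a
tangent direction is tangent. -/
def IsTotallyGeodesic
    (Db : CovariantDerivative (𝓡 (n + 2)) (EuclideanSpace ℝ (Fin (n + 2)))
      (TangentSpace (𝓡 (n + 2)) : N → Type _)) (f : M → N) : Prop :=
  ∀ (x : M) (v : TangentSpace (𝓡 (n + 1)) x) (Y : Π y : M, TangentSpace (𝓡 (n + 1)) y)
    (Yb : Π q : N, TangentSpace (𝓡 (n + 2)) q), IsExtensionAt f x Y Yb →
    ∃ u : TangentSpace (𝓡 (n + 1)) x, Db Yb (f x) (push f x v) = push f x u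

/-- `D` is the connection induced on the hypersurface: `D_v Y` is the tangential component of the
ambient derivative of `Y` in the decomposition `T N = TM ⊕ tr (TM)`, where `tr (TM)` is spanned
by `ν`. -/
def IsInducedConnection
    (Db : CovariantDerivative (𝓡 (n + 2)) (EuclideanSpace ℝ (Fin (n + 2)))
      (TangentSpace (𝓡 (n + 2)) : N → Type _)) (f : M → N)
    (ν : Π x : M, TangentSpace (𝓡 (n + 2)) (f x))
    (D : CovariantDerivative (𝓡 (n + 1)) (EuclideanSpace ℝ (Fin (n + 1)))
      (TangentSpace (𝓡 (n + 1)) : M → Type _)) : Prop :=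
  ∀ (x : M) (v : TangentSpace (𝓡 (n + 1)) x) (Y : Π y : M, TangentSpace (𝓡 (n + 1)) y)
    (Yb : Π q : N, TangentSpace (𝓡 (n + 2)) q), IsExtensionAt f x Y Yb →
    ∃ c : ℝ, Db Yb (f x) (push f x v) = push f x (D Y x v) + c • ν x

/-- The one-form `η = gb (ν, ·)`. -/
def eta (gb : LorentzianMetric (n + 2) N) (f : M → N)
    (ν : Π x : M, TangentSpace (𝓡 (n + 2)) (f x)) (x : M)
    (v : TangentSpace (𝓡 (n + 1)) x) : ℝ :=
  gb.val (f x) (ν x) (push f x v)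

/-- The projection `P v = v - η(v) ξ` of `TM` onto the screen distribution. -/
def screenProj (gb : LorentzianMetric (n + 2) N) (f : M → N)
    (ξ : Π x : M, TangentSpace (𝓡 (n + 1)) x)
    (ν : Π x : M, TangentSpace (𝓡 (n + 2)) (f x)) (x : M)
    (v : TangentSpace (𝓡 (n + 1)) x) : TangentSpace (𝓡 (n + 1)) x :=
  v - eta gb f ν x v • ξ x

/-- `v^♭ (w) = g(v, w) + η(v) η(w)`, which is also the nondegenerate metric associated with `g`. -/
def flat (gb : LorentzianMetric (n + 2) N) (f : M → N)
    (ν : Π x : M, TangentSpace (𝓡 (n + 2)) (f x)) (x : M)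
    (v w : TangentSpace (𝓡 (n + 1)) x) : ℝ :=
  indMetric gb f x v w + eta gb f ν x v * eta gb f ν x w

/-- `G` is the gradient of the function `l` with respect to the degenerate metric `g`:
`G^♭ = dl`. -/
def IsGradient (gb : LorentzianMetric (n + 2) N) (f : M → N)
    (ν : Π x : M, TangentSpace (𝓡 (n + 2)) (f x))
    (l : M → ℝ) (G : Π x : M, TangentSpace (𝓡 (n + 1)) x) : Prop :=
  ∀ (x : M) (v : TangentSpace (𝓡 (n + 1)) x),
    flat gb f ν x (G x) v = mvfderiv (𝓡 (n + 1)) l x v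

/-- The local second fundamental form of the screen distribution,
`C (v, P Y) = η (D_v (P Y))`. -/
def screenForm (gb : LorentzianMetric (n + 2) N) (f : M → N)
    (ξ : Π x : M, TangentSpace (𝓡 (n + 1)) x)
    (ν : Π x : M, TangentSpace (𝓡 (n + 2)) (f x))
    (D : CovariantDerivative (𝓡 (n + 1)) (EuclideanSpace ℝ (Fin (n + 1)))
      (TangentSpace (𝓡 (n + 1)) : M → Type _))
    (x : M) (v : TangentSpace (𝓡 (n + 1)) x) (Y : Π y : M, TangentSpace (𝓡 (n + 1)) y) : ℝ :=
  eta gb f ν x (D (fun y ↦ screenProj gb f ξ ν y (Y y)) x v)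

/-- `S` is an `A^∇`-tensor: a smooth endomorphism field which preserves the screen (commutes
with `P`), is symmetric for `g`, and satisfies `X^♭ (∇S (X, X)) = 0`. -/
structure IsANablaTensor (gb : LorentzianMetric (n + 2) N) (f : M → N)
    (ξ : Π x : M, TangentSpace (𝓡 (n + 1)) x)
    (ν : Π x : M, TangentSpace (𝓡 (n + 2)) (f x))
    (D : CovariantDerivative (𝓡 (n + 1)) (EuclideanSpace ℝ (Fin (n + 1)))
      (TangentSpace (𝓡 (n + 1)) : M → Type _))
    (S : ∀ x : M, TangentSpace (𝓡 (n + 1)) x →L[ℝ] TangentSpace (𝓡 (n + 1)) x) : Prop where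
  smooth : ContMDiff (𝓡 (n + 1))
    ((𝓡 (n + 1)).prod
      𝓘(ℝ, EuclideanSpace ℝ (Fin (n + 1)) →L[ℝ] EuclideanSpace ℝ (Fin (n + 1)))) ∞
    (fun x : M ↦ Bundle.TotalSpace.mk'
      (EuclideanSpace ℝ (Fin (n + 1)) →L[ℝ] EuclideanSpace ℝ (Fin (n + 1)))
      (E := fun x : M ↦ TangentSpace (𝓡 (n + 1)) x →L[ℝ] TangentSpace (𝓡 (n + 1)) x) x (S x))
  screen_preserving : ∀ (x : M) (v : TangentSpace (𝓡 (n + 1)) x),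
    S x (screenProj gb f ξ ν x v) = screenProj gb f ξ ν x (S x v)
  symmetric : ∀ (x : M) (v w : TangentSpace (𝓡 (n + 1)) x),
    indMetric gb f x (S x v) w = indMetric gb f x v (S x w)
  flat_eq_zero : ∀ (x : M) (X : Π y : M, TangentSpace (𝓡 (n + 1)) y), DiffFieldAt X x →
    flat gb f ν x (X x) (covEnd D S x (X x) X) = 0

/-- `l 0, …, l k` are the eigenfunctions of `S`: smooth functions whose values at each point are
the distinct eigenvalues of `S` there, numbered so that `Ker (S - l 0)` is the radical. -/
structure IsEigenfunctions {k : ℕ} (gb : LorentzianMetric (n + 2) N) (f : M → N)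
    (S : ∀ x : M, TangentSpace (𝓡 (n + 1)) x →L[ℝ] TangentSpace (𝓡 (n + 1)) x)
    (l : Fin (k + 1) → M → ℝ) : Prop where
  smooth : ∀ α, ContMDiff (𝓡 (n + 1)) 𝓘(ℝ, ℝ) ∞ (l α)
  distinct : ∀ x : M, Function.Injective (fun α ↦ l α x)
  hasEigenvalue_iff : ∀ (x : M) (μ : ℝ),
    Module.End.HasEigenvalue (S x).toLinearMap μ ↔ ∃ α, l α x = μ
  eigenDist_zero : ∀ x : M, eigenDist S (l 0) x = radical gb f x

end Hypersurface

end NullGeometry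

end

open NullGeometry

/-!
Since the hypersurface is totally geodesic, the ambient derivative of a tangent field has no
transversal component, so the induced connection is torsion-free and compatible with the degenerate
metric `g` (`induced_torsion_free`, `induced_metric`). To pass from the ambient space to the
hypersurface, tangent fields are extended in charts adapted to the immersion, in a way that respects
the bracket (`exists_extension_operator`).

The form `g + η ⊗ η` is positive definite, because a Lorentzian form is nonnegative on the
orthogonal complement of a null vector. The operator `S` is symmetric for it, hence diagonalizable
(`iSup_eigenDist`), and its eigenprojections are Lagrange polynomials in `S` with smooth
coefficients. Every eigenvector therefore extends to a smooth eigensection. The condition on the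
gradients says that the eigenfunctions have no derivative along the screen, so for eigensections
`X ∈ D i`, `Y ∈ D j`, `Z ∈ D p` with `X` in the screen,
`⟨∇S (X, Y), Z⟩ = (l j - l p) ⟨∇_X Y, Z⟩` (`inner_covEnd`).

It remains to see that this cubic form vanishes on the screen (`inner_covEnd_eq_zero`). It does so
trivially for `j = p`. For three distinct indices, integrability of the sums of two
eigendistributions makes `⟨∇_X Y, Z⟩` symmetric in `X, Y`, while metric compatibility makes it
alternating in `Y, Z`; hence it is zero (`inner_cov_eq_zero`). If two indices agree, the
polarization of `X^♭ (∇S (X, X)) = 0` and the integrability of a single eigendistribution suffice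
(`inner_covEnd_diagonal`). So `∇S (X, Y)` is a multiple of `ξ`, and the coefficient is its image
under `η`, computed from `η ∘ S = l 0 • η`.
-/

namespace NullGeometry

/-! ### Transport of vector fields along immersions -/

section Charts

open VectorField Set

variable {E E' : Type*} [NormedAddCommGroup E] [NormedSpace ℝ E] [CompleteSpace E]
  [NormedAddCommGroup E'] [NormedSpace ℝ E'] [CompleteSpace E']
  {M : Type*} [TopologicalSpace M] [ChartedSpace E M] [IsManifold 𝓘(ℝ, E) ∞ M]

lemma contMDiffAt_chart {e : OpenPartialHomeomorph M E}
    (he : e ∈ IsManifold.maximalAtlas 𝓘(ℝ, E) ∞ M) {x : M} (hx : x ∈ e.source) :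
    ContMDiffAt 𝓘(ℝ, E) 𝓘(ℝ, E) ∞ e x :=
  (contMDiffOn_of_mem_maximalAtlas he).contMDiffAt (e.open_source.mem_nhds hx)

lemma contMDiffAt_chart_symm {e : OpenPartialHomeomorph M E}
    (he : e ∈ IsManifold.maximalAtlas 𝓘(ℝ, E) ∞ M) {p : E} (hp : p ∈ e.target) :
    ContMDiffAt 𝓘(ℝ, E) 𝓘(ℝ, E) ∞ e.symm p :=
  (contMDiffOn_symm_of_mem_maximalAtlas he).contMDiffAt (e.open_target.mem_nhds hp)

lemma mdifferentiable_chart_of_mem {e : OpenPartialHomeomorph M E}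
    (he : e ∈ IsManifold.maximalAtlas 𝓘(ℝ, E) ∞ M) :
    e.MDifferentiable 𝓘(ℝ, E) 𝓘(ℝ, E) :=
  ⟨fun _ hx ↦ ((contMDiffAt_chart he hx).mdifferentiableAt (by simp)).mdifferentiableWithinAt,
   fun _ hx ↦ ((contMDiffAt_chart_symm he hx).mdifferentiableAt (by simp)).mdifferentiableWithinAt⟩

lemma isInvertible_mfderiv_chart {e : OpenPartialHomeomorph M E}
    (he : e ∈ IsManifold.maximalAtlas 𝓘(ℝ, E) ∞ M) {x : M} (hx : x ∈ e.source) :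
    (mfderiv 𝓘(ℝ, E) 𝓘(ℝ, E) e x).IsInvertible :=
  ⟨(mdifferentiable_chart_of_mem he).mfderiv hx, rfl⟩

lemma isInvertible_mfderiv_chart_symm {e : OpenPartialHomeomorph M E}
    (he : e ∈ IsManifold.maximalAtlas 𝓘(ℝ, E) ∞ M) {p : E} (hp : p ∈ e.target) :
    (mfderiv 𝓘(ℝ, E) 𝓘(ℝ, E) e.symm p).IsInvertible :=
  ⟨(mdifferentiable_chart_of_mem he).symm.mfderiv hp, rfl⟩

lemma mfderiv_mpullback_chart {e : OpenPartialHomeomorph M E}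
    (he : e ∈ IsManifold.maximalAtlas 𝓘(ℝ, E) ∞ M) {x : M} (hx : x ∈ e.source)
    (W : Π p : E, TangentSpace 𝓘(ℝ, E) p) :
    mfderiv 𝓘(ℝ, E) 𝓘(ℝ, E) e x (mpullback 𝓘(ℝ, E) 𝓘(ℝ, E) e W x) = W (e x) := by
  rw [mpullback_apply, ContinuousLinearMap.IsInvertible.self_apply_inverse]
  exact isInvertible_mfderiv_chart he hx

lemma mpullback_chart_symm {e : OpenPartialHomeomorph M E}
    (he : e ∈ IsManifold.maximalAtlas 𝓘(ℝ, E) ∞ M) {x : M} (hx : x ∈ e.source)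
    (V : Π y : M, TangentSpace 𝓘(ℝ, E) y) :
    mpullback 𝓘(ℝ, E) 𝓘(ℝ, E) e.symm V (e x) = mfderiv 𝓘(ℝ, E) 𝓘(ℝ, E) e x (V x) := by
  have h1 := isInvertible_mfderiv_chart_symm he (e.map_source hx)
  rw [mpullback_apply, h1.inverse_apply_eq]
  have h2 := (mdifferentiable_chart_of_mem he).symm_comp_deriv hx
  have h3 := congrArg (fun T ↦ T (V x)) h2
  rw [e.left_inv hx]
  exact h3.symm

lemma mlieBracket_eq_lieBracket (V W : Π p : E, TangentSpace 𝓘(ℝ, E) p) (p : E) :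
    mlieBracket 𝓘(ℝ, E) V W p = lieBracket ℝ (V : E → E) (W : E → E) p := by
  rw [← mlieBracketWithin_univ, mlieBracketWithin_eq_lieBracketWithin]
  exact congrFun lieBracketWithin_univ p

/-- A differentiable vector field on a vector space is a differentiable map. -/
lemma mdifferentiableAt_field_iff (V : Π p : E, TangentSpace 𝓘(ℝ, E) p) (p : E) :
    MDifferentiableAt 𝓘(ℝ, E) 𝓘(ℝ, E).tangent
      (fun q ↦ (⟨q, V q⟩ : TangentBundle 𝓘(ℝ, E) E)) p ↔ DifferentiableAt ℝ (V : E → E) p := by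
  rw [mdifferentiableAt_section]
  refine Iff.trans ?_ (mdifferentiableAt_iff_differentiableAt (f := (V : E → E)))
  simp

/-- The bracket of two vector fields read in a chart. Only differentiability at the point is
required, as the inverse chart is smooth. -/
lemma mfderiv_mlieBracket_chart {e : OpenPartialHomeomorph M E}
    (he : e ∈ IsManifold.maximalAtlas 𝓘(ℝ, E) ∞ M) {x : M} (hx : x ∈ e.source)
    {V W : Π y : M, TangentSpace 𝓘(ℝ, E) y}
    (hV : MDifferentiableAt 𝓘(ℝ, E) 𝓘(ℝ, E).tangent
      (fun y ↦ (⟨y, V y⟩ : TangentBundle 𝓘(ℝ, E) M)) x)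
    (hW : MDifferentiableAt 𝓘(ℝ, E) 𝓘(ℝ, E).tangent
      (fun y ↦ (⟨y, W y⟩ : TangentBundle 𝓘(ℝ, E) M)) x) :
    mfderiv 𝓘(ℝ, E) 𝓘(ℝ, E) e x (mlieBracket 𝓘(ℝ, E) V W x) =
      lieBracket ℝ (mpullback 𝓘(ℝ, E) 𝓘(ℝ, E) e.symm V)
        (mpullback 𝓘(ℝ, E) 𝓘(ℝ, E) e.symm W) (e x) := by
  have : IsManifold 𝓘(ℝ, E) (minSmoothness ℝ 2) M := by simp; infer_instance
  rw [← mpullback_chart_symm he hx, mpullback_mlieBracket (n := ∞), mlieBracket_eq_lieBracket]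
  · rwa [e.left_inv hx]
  · rwa [e.left_inv hx]
  · exact contMDiffAt_chart_symm he (e.map_source hx)
  · simpa using ENat.LEInfty.out

lemma differentiableAt_mpullback_chart_symm {e : OpenPartialHomeomorph M E}
    (he : e ∈ IsManifold.maximalAtlas 𝓘(ℝ, E) ∞ M) {x : M} (hx : x ∈ e.source)
    {V : Π y : M, TangentSpace 𝓘(ℝ, E) y}
    (hV : MDifferentiableAt 𝓘(ℝ, E) 𝓘(ℝ, E).tangent
      (fun y ↦ (⟨y, V y⟩ : TangentBundle 𝓘(ℝ, E) M)) x) :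
    DifferentiableAt ℝ (mpullback 𝓘(ℝ, E) 𝓘(ℝ, E) e.symm V : E → E) (e x) := by
  have hV' : MDifferentiableAt 𝓘(ℝ, E) 𝓘(ℝ, E).tangent
      (fun y ↦ (⟨y, V y⟩ : TangentBundle 𝓘(ℝ, E) M)) (e.symm (e x)) := by rwa [e.left_inv hx]
  have h := hV'.mpullback_vectorField (n := ∞) (contMDiffAt_chart_symm he (e.map_source hx))
    (isInvertible_mfderiv_chart_symm he (e.map_source hx)) ENat.LEInfty.out
  exact (mdifferentiableAt_field_iff _ _).1 h

/-- For a split injection `L` with retraction `R`, the extension `L ∘ V ∘ R` of a vector field `V`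
from the range of `L` to the whole space, constant along the kernel of `R`, commutes with the
bracket on the range of `L`. -/
lemma lieBracket_retract {F : Type*} [NormedAddCommGroup F] [NormedSpace ℝ F]
    (L : E →L[ℝ] F) (R : F →L[ℝ] E) (hRL : ∀ u, R (L u) = u) {V W : E → E} {u : E}
    (hV : DifferentiableAt ℝ V u) (hW : DifferentiableAt ℝ W u) :
    lieBracket ℝ (fun p ↦ L (V (R p))) (fun p ↦ L (W (R p))) (L u) = L (lieBracket ℝ V W u) := by
  have key : ∀ Z : E → E, DifferentiableAt ℝ Z u →
      HasFDerivAt (fun p ↦ L (Z (R p))) (L ∘L (fderiv ℝ Z u) ∘L R) (L u) := by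
    intro Z hZ
    have h1 : HasFDerivAt Z (fderiv ℝ Z u) (R (L u)) := by rw [hRL]; exact hZ.hasFDerivAt
    exact L.hasFDerivAt.comp _ (h1.comp _ R.hasFDerivAt)
  rw [lieBracket_eq, lieBracket_eq]
  simp [(key V hV).fderiv, (key W hW).fderiv, hRL]

variable {N : Type*} [TopologicalSpace N] [ChartedSpace E' N] [IsManifold 𝓘(ℝ, E') ∞ N]

/-- Near a point, an immersion admits an operator extending vector fields of the source to vector
fields of the target which preserves differentiability and the bracket at that point. In adapted
charts the immersion is a split injection, and a field is extended constantly along a complement of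
the image. The fields are only assumed differentiable at the point. -/
theorem exists_extension_operator {f : M → N} {x : M}
    (hf : Manifold.IsImmersionAt 𝓘(ℝ, E) 𝓘(ℝ, E') ∞ f x) :
    ∃ ext : (Π y : M, TangentSpace 𝓘(ℝ, E) y) → (Π q : N, TangentSpace 𝓘(ℝ, E') q),
      (∀ V, MDifferentiableAt 𝓘(ℝ, E) 𝓘(ℝ, E).tangent
          (fun y ↦ (⟨y, V y⟩ : TangentBundle 𝓘(ℝ, E) M)) x →
        MDifferentiableAt 𝓘(ℝ, E') 𝓘(ℝ, E').tangent
          (fun q ↦ (⟨q, ext V q⟩ : TangentBundle 𝓘(ℝ, E') N)) (f x)) ∧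
      (∀ V, ∀ᶠ y in 𝓝 x, ext V (f y) = mfderiv 𝓘(ℝ, E) 𝓘(ℝ, E') f y (V y)) ∧
      (∀ V W, MDifferentiableAt 𝓘(ℝ, E) 𝓘(ℝ, E).tangent
          (fun y ↦ (⟨y, V y⟩ : TangentBundle 𝓘(ℝ, E) M)) x →
        MDifferentiableAt 𝓘(ℝ, E) 𝓘(ℝ, E).tangent
          (fun y ↦ (⟨y, W y⟩ : TangentBundle 𝓘(ℝ, E) M)) x →
        mlieBracket 𝓘(ℝ, E') (ext V) (ext W) (f x) =
          mfderiv 𝓘(ℝ, E) 𝓘(ℝ, E') f x (mlieBracket 𝓘(ℝ, E) V W x)) := by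
  have : IsManifold 𝓘(ℝ, E') (minSmoothness ℝ 2) N := by simp; infer_instance
  set e := hf.domChart with he_def
  set c := hf.codChart with hc_def
  have he : e ∈ IsManifold.maximalAtlas 𝓘(ℝ, E) ∞ M := hf.domChart_mem_maximalAtlas
  have hc : c ∈ IsManifold.maximalAtlas 𝓘(ℝ, E') ∞ N := hf.codChart_mem_maximalAtlas
  have hxe : x ∈ e.source := hf.mem_domChart_source
  -- in the adapted charts `f` is `L`, with retraction `R`
  let L : E →L[ℝ] E' := hf.equiv.toContinuousLinearMap ∘L ContinuousLinearMap.inl ℝ E hf.complement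
  let R : E' →L[ℝ] E := ContinuousLinearMap.fst ℝ E hf.complement ∘L
    hf.equiv.symm.toContinuousLinearMap
  have hRL : ∀ u, R (L u) = u := fun u ↦ by simp [R, L]
  have hsrc : ∀ y ∈ e.source, f y ∈ c.source := fun y hy ↦ hf.source_subset_preimage_source hy
  have hcf : ∀ y ∈ e.source, c (f y) = L (e y) := by
    intro y hy
    have h := hf.writtenInCharts (show e y ∈ (hf.domChart.extend 𝓘(ℝ, E)).target by
      simpa using e.map_source hy)
    simpa [L, ← he_def, ← hc_def, e.left_inv hy] using h
  -- the chart expression of `f` is `L`, hence `dc ∘ df = L ∘ de`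
  have hder : ∀ y ∈ e.source, ∀ v : TangentSpace 𝓘(ℝ, E) y,
      mfderiv 𝓘(ℝ, E') 𝓘(ℝ, E') c (f y) (mfderiv 𝓘(ℝ, E) 𝓘(ℝ, E') f y v) =
        L (mfderiv 𝓘(ℝ, E) 𝓘(ℝ, E) e y v) := by
    intro y hy v
    have hfy : MDifferentiableAt 𝓘(ℝ, E) 𝓘(ℝ, E') f y :=
      (hf.contMDiffOn.contMDiffAt (e.open_source.mem_nhds hy)).mdifferentiableAt (by simp)
    have h1 : HasMFDerivAt 𝓘(ℝ, E) 𝓘(ℝ, E') (c ∘ f) y _ :=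
      ((contMDiffAt_chart hc (hsrc y hy)).mdifferentiableAt (by simp)).hasMFDerivAt.comp y
        hfy.hasMFDerivAt
    have h2 : HasMFDerivAt 𝓘(ℝ, E) 𝓘(ℝ, E') (L ∘ e) y _ :=
      L.hasMFDerivAt.comp y
        ((contMDiffAt_chart he hy).mdifferentiableAt (by simp)).hasMFDerivAt
    have h3 : HasMFDerivAt 𝓘(ℝ, E) 𝓘(ℝ, E') (c ∘ f) y _ :=
      h2.congr_of_eventuallyEq (by
        filter_upwards [e.open_source.mem_nhds hy] with z hz using hcf z hz)
    exact congrArg (fun T ↦ T v) (hasMFDerivAt_unique h1 h3)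
  let F (V : Π y : M, TangentSpace 𝓘(ℝ, E) y) : Π p : E', TangentSpace 𝓘(ℝ, E') p :=
    fun p ↦ L (mpullback 𝓘(ℝ, E) 𝓘(ℝ, E) e.symm V (R p))
  have hF : ∀ V, MDifferentiableAt 𝓘(ℝ, E) 𝓘(ℝ, E).tangent
      (fun y ↦ (⟨y, V y⟩ : TangentBundle 𝓘(ℝ, E) M)) x →
      MDifferentiableAt 𝓘(ℝ, E') 𝓘(ℝ, E').tangent
        (fun p ↦ (⟨p, F V p⟩ : TangentBundle 𝓘(ℝ, E') E')) (c (f x)) := by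
    intro V hV
    have h1 := differentiableAt_mpullback_chart_symm he hxe hV
    have h2 : DifferentiableAt ℝ (F V : E' → E') (c (f x)) := by
      have h2 : DifferentiableAt ℝ (mpullback 𝓘(ℝ, E) 𝓘(ℝ, E) e.symm V : E → E)
          (R (c (f x))) := by
        rw [hcf x hxe, hRL]
        exact h1
      exact L.differentiableAt.comp _ (h2.comp _ R.differentiableAt)
    exact (mdifferentiableAt_field_iff _ _).2 h2
  refine ⟨fun V ↦ mpullback 𝓘(ℝ, E') 𝓘(ℝ, E') c (F V), ?_, ?_, ?_⟩
  · intro V hV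
    exact (hF V hV).mpullback_vectorField (n := ∞) (contMDiffAt_chart hc (hsrc x hxe))
      (isInvertible_mfderiv_chart hc (hsrc x hxe)) ENat.LEInfty.out
  · intro V
    filter_upwards [e.open_source.mem_nhds hxe] with y hy
    apply (isInvertible_mfderiv_chart hc (hsrc y hy)).injective
    rw [mfderiv_mpullback_chart hc (hsrc y hy), hder y hy, hcf y hy]
    simp only [F]
    rw [hRL, mpullback_chart_symm he hy]
  · intro V W hV hW
    apply (isInvertible_mfderiv_chart hc (hsrc x hxe)).injective
    rw [hder x hxe, ← mpullback_mlieBracket (n := ∞) (hF V hV) (hF W hW)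
      (contMDiffAt_chart hc (hsrc x hxe)) (by simpa using ENat.LEInfty.out),
      mfderiv_mpullback_chart hc (hsrc x hxe),
      mfderiv_mlieBracket_chart he hxe hV hW, mlieBracket_eq_lieBracket, hcf x hxe]
    exact lieBracket_retract L R hRL (differentiableAt_mpullback_chart_symm he hxe hV)
      (differentiableAt_mpullback_chart_symm he hxe hW)

end Charts

/-! ### Linear algebra -/

section LinearAlgebra

variable {V : Type*} [AddCommGroup V] [Module ℝ V]

/-- In a Lorentzian vector space the form is nonnegative on the orthogonal complement of a nonzero
null vector: this is the Cauchy-Schwarz inequality for the spacelike coordinates. -/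
lemma nonneg_of_orthogonal_null {n : ℕ} (B : V →ₗ[ℝ] V →ₗ[ℝ] ℝ)
    (b : Module.Basis (Fin (n + 1)) ℝ V)
    (hb : ∀ i j, B (b i) (b j) = if i = j then (if (i : ℕ) = 0 then -1 else 1) else 0)
    {e w : V} (he : e ≠ 0) (hee : B e e = 0) (hew : B e w = 0) : 0 ≤ B w w := by
  have hB : ∀ v u : V, B v u = -(b.repr v 0 * b.repr u 0)
      + ∑ i : Fin n, b.repr v i.succ * b.repr u i.succ := by
    intro v u
    have h1 : B v u = ∑ i, b.repr v i * b.repr u i * (if (i : ℕ) = 0 then -1 else 1) := by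
      conv_lhs => rw [← b.sum_repr v, ← b.sum_repr u]
      simp only [map_sum, LinearMap.sum_apply, map_smul, LinearMap.smul_apply, hb, smul_eq_mul]
      refine Finset.sum_congr rfl fun i _ ↦ ?_
      rw [Finset.sum_eq_single i]
      · simp only [if_true]; ring
      · intro j _ hj; simp [hj]
      · simp
    rw [h1, Fin.sum_univ_succ]
    simp
  rw [hB] at hee hew ⊢
  set a := ∑ i : Fin n, b.repr e i.succ * b.repr e i.succ with ha
  have ha0 : 0 ≤ a := Finset.sum_nonneg fun i _ ↦ mul_self_nonneg _
  have hapos : 0 < a := by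
    rcases ha0.lt_or_eq with h | h
    · exact h
    · exfalso
      apply he
      have h0 : b.repr e 0 = 0 := by nlinarith
      have hs := (Finset.sum_eq_zero_iff_of_nonneg
        (fun i _ ↦ mul_self_nonneg (b.repr e (Fin.succ i)))).1 h.symm
      apply b.repr.map_eq_zero_iff.1
      ext i
      refine Fin.cases (by simpa using h0) (fun j ↦ ?_) i
      simpa using hs j (Finset.mem_univ j)
  have hcs := Finset.sum_mul_sq_le_sq_mul_sq Finset.univ (fun i : Fin n ↦ b.repr e i.succ)
    (fun i ↦ b.repr w i.succ)
  simp only [pow_two] at hcs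
  rw [← ha] at hcs
  have h1 : ∑ i : Fin n, b.repr e i.succ * b.repr w i.succ = b.repr e 0 * b.repr w 0 := by linarith
  have h2 : b.repr e 0 * b.repr e 0 = a := by linarith
  rw [h1] at hcs
  have h3 : a * (b.repr w 0 * b.repr w 0) ≤ a * ∑ i : Fin n, b.repr w i.succ * b.repr w i.succ := by
    calc _ = b.repr e 0 * b.repr w 0 * (b.repr e 0 * b.repr w 0) := by rw [← h2]; ring
      _ ≤ _ := hcs
  have := le_of_mul_le_mul_left h3 hapos
  linarith

/-- A null vector of a positive semidefinite form lies in its radical. -/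
lemma apply_eq_zero_of_nonneg (B : V →ₗ[ℝ] V →ₗ[ℝ] ℝ) (hsymm : ∀ v w, B v w = B w v)
    (hpos : ∀ v, 0 ≤ B v v) {w : V} (hw : B w w = 0) (u : V) : B w u = 0 := by
  by_contra h
  -- with this coefficient the value of the form is `-1`
  have h1 := hpos (u + (-(B u u + 1) / (2 * B w u)) • w)
  simp only [map_add, LinearMap.add_apply, map_smul, LinearMap.smul_apply, smul_eq_mul, hw,
    hsymm u w] at h1
  have h2 : -(B u u + 1) / (2 * B w u) * B w u = -(B u u + 1) / 2 := by field_simp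
  simp only [h2] at h1
  linarith

/-- An endomorphism which is symmetric for some positive definite form is diagonalizable. -/
lemma iSup_eigenspace_eq_top_of_symmetric [FiniteDimensional ℝ V] (B : V →ₗ[ℝ] V →ₗ[ℝ] ℝ)
    (hsymm : ∀ v w, B v w = B w v) (hpos : ∀ v, v ≠ 0 → 0 < B v v) (T : Module.End ℝ V)
    (hT : ∀ v w, B (T v) w = B v (T w)) : ⨆ μ : ℝ, Module.End.eigenspace T μ = ⊤ := by
  let core : InnerProductSpace.Core ℝ V :=
    { inner := fun v w ↦ B v w
      conj_inner_symm := fun v w ↦ by simp [hsymm v w]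
      re_inner_nonneg := fun v ↦ by
        by_cases h : v = 0
        · simp [h]
        · simpa using (hpos v h).le
      add_left := fun _ _ _ ↦ by simp
      smul_left := fun _ _ _ ↦ by simp
      definite := fun v h ↦ by
        by_contra hv
        exact (hpos v hv).ne' h }
  let _ : NormedAddCommGroup V := core.toNormedAddCommGroup
  let _ : InnerProductSpace ℝ V := InnerProductSpace.ofCore core.toCore
  have hsym : LinearMap.IsSymmetric T := fun v w ↦ hT v w
  exact Submodule.orthogonal_eq_bot_iff.1 hsym.orthogonalComplement_iSup_eigenspaces_eq_bot

/-- The projection onto the eigenspace of `T` for the eigenvalue `l j`, as the Lagrange polynomial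
`∏ m ≠ j, (T - l m) / (l j - l m)` in `T`. It has this meaning when `T` is diagonalizable with
distinct eigenvalues `l 0, …, l k`. -/
noncomputable def eigenProj {k : ℕ} (T : Module.End ℝ V) (l : Fin (k + 1) → ℝ) (j : Fin (k + 1)) :
    Module.End ℝ V :=
  Polynomial.aeval T (Lagrange.basis Finset.univ l j)

variable {k : ℕ} {T : Module.End ℝ V} {l : Fin (k + 1) → ℝ}

lemma eigenProj_of_mem (hl : Function.Injective l) {i : Fin (k + 1)} {v : V}
    (hv : v ∈ Module.End.eigenspace T (l i)) (j : Fin (k + 1)) :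
    eigenProj T l j v = if i = j then v else 0 := by
  by_cases h0 : v = 0
  · simp [h0]
  have h1 := Module.End.aeval_apply_of_hasEigenvector (p := Lagrange.basis Finset.univ l j) ⟨hv, h0⟩
  rw [eigenProj, h1]
  split_ifs with h
  · subst h
    rw [Lagrange.eval_basis_self hl.injOn (Finset.mem_univ _), one_smul]
  · rw [Lagrange.eval_basis_of_ne (Ne.symm h) (Finset.mem_univ _), zero_smul]

/-- The eigenprojections sum to the identity, diagonalizable or not, because the Lagrange basis
polynomials sum to `1`. -/
lemma sum_eigenProj (hl : Function.Injective l) (v : V) : ∑ j, eigenProj T l j v = v := by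
  have h := congrArg (fun p ↦ Polynomial.aeval T p v)
    (Lagrange.sum_basis hl.injOn (Finset.univ_nonempty (α := Fin (k + 1))))
  simpa [eigenProj, map_sum, LinearMap.sum_apply] using h

lemma eigenProj_mem (hl : Function.Injective l) (htop : ⨆ i, Module.End.eigenspace T (l i) = ⊤)
    (j : Fin (k + 1)) (v : V) : eigenProj T l j v ∈ Module.End.eigenspace T (l j) := by
  have hv : v ∈ ⨆ i, Module.End.eigenspace T (l i) := htop ▸ Submodule.mem_top
  induction hv using Submodule.iSup_induction' with
  | mem i v hv =>
    rw [eigenProj_of_mem hl hv]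
    split_ifs with h
    · exact h ▸ hv
    · exact zero_mem _
  | zero => simp
  | add v w _ _ h1 h2 => rw [map_add]; exact add_mem h1 h2

end LinearAlgebra

/-! ### The induced connection of a totally geodesic hypersurface -/

section InducedConnection

variable {n : ℕ}
  {M : Type*} [TopologicalSpace M] [ChartedSpace (EuclideanSpace ℝ (Fin (n + 1))) M]
  [IsManifold (𝓡 (n + 1)) ∞ M]
  {N : Type*} [TopologicalSpace N] [ChartedSpace (EuclideanSpace ℝ (Fin (n + 2))) N]
  [IsManifold (𝓡 (n + 2)) ∞ N]
  {gb : LorentzianMetric (n + 2) N}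
  {Db : CovariantDerivative (𝓡 (n + 2)) (EuclideanSpace ℝ (Fin (n + 2)))
      (TangentSpace (𝓡 (n + 2)) : N → Type _)}
  {f : M → N} {sc : ∀ x : M, Submodule ℝ (TangentSpace (𝓡 (n + 1)) x)}
  {ξ : Π x : M, TangentSpace (𝓡 (n + 1)) x} {ν : Π x : M, TangentSpace (𝓡 (n + 2)) (f x)}
  {D : CovariantDerivative (𝓡 (n + 1)) (EuclideanSpace ℝ (Fin (n + 1)))
      (TangentSpace (𝓡 (n + 1)) : M → Type _)}

lemma isImmersionAt_of_isLightlike (hf : IsLightlikeHypersurface gb f) (x : M) :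
    Manifold.IsImmersionAt (𝓡 (n + 1)) (𝓡 (n + 2)) ∞ f x :=
  hf.immersion.isImmersionAt x

lemma mdifferentiableAt_of_isLightlike (hf : IsLightlikeHypersurface gb f) (x : M) :
    MDifferentiableAt (𝓡 (n + 1)) (𝓡 (n + 2)) f x :=
  (isImmersionAt_of_isLightlike hf x).contMDiffAt.mdifferentiableAt (by simp)

/-- Any two differentiable tangent fields have ambient extensions whose bracket extends the
bracket at the given point. -/
lemma exists_isExtensionAt₂ (hf : IsLightlikeHypersurface gb f) {x : M}
    {X Y : Π y : M, TangentSpace (𝓡 (n + 1)) y} (hX : DiffFieldAt X x) (hY : DiffFieldAt Y x) :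
    ∃ Xb Yb : Π q : N, TangentSpace (𝓡 (n + 2)) q,
      IsExtensionAt f x X Xb ∧ IsExtensionAt f x Y Yb ∧
      VectorField.mlieBracket (𝓡 (n + 2)) Xb Yb (f x) =
        push f x (VectorField.mlieBracket (𝓡 (n + 1)) X Y x) := by
  obtain ⟨ext, h1, h2, h3⟩ := exists_extension_operator (isImmersionAt_of_isLightlike hf x)
  exact ⟨ext X, ext Y, ⟨hX, h1 X hX, h2 X⟩, ⟨hY, h1 Y hY, h2 Y⟩, h3 X Y hX hY⟩

/-- On a totally geodesic hypersurface the ambient connection has no transversal component. -/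
lemma ambient_eq_push (hgeo : IsTotallyGeodesic Db f) (hξ : IsNullSection gb f ξ)
    (hν : IsNullTransversal gb f sc ξ ν) (hD : IsInducedConnection Db f ν D) {x : M}
    {Y : Π y : M, TangentSpace (𝓡 (n + 1)) y} {Yb : Π q : N, TangentSpace (𝓡 (n + 2)) q}
    (h : IsExtensionAt f x Y Yb) (v : TangentSpace (𝓡 (n + 1)) x) :
    Db Yb (f x) (push f x v) = push f x (D Y x v) := by
  obtain ⟨u, hu⟩ := hgeo x v Y Yb h
  obtain ⟨c, hc⟩ := hD x v Y Yb h
  have hrad : ∀ w, gb.val (f x) (push f x w) (push f x (ξ x)) = 0 := fun w ↦ by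
    rw [gb.symm]; exact hξ.mem_radical x w
  -- pairing with `ξ` detects the transversal component
  have h1 : gb.val (f x) (push f x u) (push f x (ξ x)) =
      gb.val (f x) (push f x (D Y x v) + c • ν x) (push f x (ξ x)) := by rw [← hu, hc]
  simp only [map_add, map_smul, add_apply, smul_apply,
    hrad, hν.inner_xi, smul_eq_mul] at h1
  have hc0 : c = 0 := by linarith
  rw [hc, hc0, zero_smul, add_zero]

/-- The induced connection is torsion-free. The identity is stated after pushing forward, the form
in which it is used and for which injectivity of `push` is not needed. -/
lemma induced_torsion_free (hDb : IsLeviCivita gb Db) (hf : IsLightlikeHypersurface gb f)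
    (hgeo : IsTotallyGeodesic Db f) (hξ : IsNullSection gb f ξ)
    (hν : IsNullTransversal gb f sc ξ ν) (hD : IsInducedConnection Db f ν D) {x : M}
    {X Y : Π y : M, TangentSpace (𝓡 (n + 1)) y} (hX : DiffFieldAt X x) (hY : DiffFieldAt Y x) :
    push f x (D Y x (X x)) - push f x (D X x (Y x)) =
      push f x (VectorField.mlieBracket (𝓡 (n + 1)) X Y x) := by
  obtain ⟨Xb, Yb, hXb, hYb, hbr⟩ := exists_isExtensionAt₂ hf hX hY
  rw [← hbr, ← hDb.torsion_free (f x) Xb Yb hXb.2.1 hYb.2.1, ← ambient_eq_push hgeo hξ hν hD hXb,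
    ← ambient_eq_push hgeo hξ hν hD hYb, hXb.2.2.self_of_nhds, hYb.2.2.self_of_nhds]

/-- The induced connection is compatible with the degenerate metric.  For a general lightlike
hypersurface this fails; here the transversal component of the ambient derivative vanishes. -/
lemma induced_metric (hDb : IsLeviCivita gb Db) (hf : IsLightlikeHypersurface gb f)
    (hgeo : IsTotallyGeodesic Db f) (hξ : IsNullSection gb f ξ)
    (hν : IsNullTransversal gb f sc ξ ν) (hD : IsInducedConnection Db f ν D) {x : M}
    (v : TangentSpace (𝓡 (n + 1)) x)
    {Y Z : Π y : M, TangentSpace (𝓡 (n + 1)) y} (hY : DiffFieldAt Y x) (hZ : DiffFieldAt Z x) :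
    mvfderiv (𝓡 (n + 1)) (fun y ↦ indMetric gb f y (Y y) (Z y)) x v =
      indMetric gb f x (D Y x v) (Z x) + indMetric gb f x (Y x) (D Z x v) := by
  obtain ⟨Yb, Zb, hYb, hZb, -⟩ := exists_isExtensionAt₂ hf hY hZ
  have h1 := hDb.metric (f x) (push f x v) Yb Zb hYb.2.1 hZb.2.1
  rw [ambient_eq_push hgeo hξ hν hD hYb, ambient_eq_push hgeo hξ hν hD hZb,
    hYb.2.2.self_of_nhds, hZb.2.2.self_of_nhds] at h1
  have hgd : MDifferentiableAt (𝓡 (n + 2)) 𝓘(ℝ, ℝ) (fun q ↦ gb.val q (Yb q) (Zb q)) (f x) := by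
    have h2 := MDifferentiableAt.clm_bundle_apply₂
      (E₃ := Bundle.Trivial N ℝ) (F₃ := ℝ) (b := fun q : N ↦ q)
      ((gb.contMDiff.contMDiffAt (x := f x)).mdifferentiableAt (by simp)) hYb.2.1 hZb.2.1
    rw [mdifferentiableAt_totalSpace] at h2
    exact h2.2
  have hcongr : (fun y ↦ indMetric gb f y (Y y) (Z y)) =ᶠ[𝓝 x]
      (fun q ↦ gb.val q (Yb q) (Zb q)) ∘ f := by
    filter_upwards [hYb.2.2, hZb.2.2] with y hy hz
    simp only [Function.comp_apply, indMetric, hy, hz]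
  have h3 := (hgd.hasMFDerivAt.comp x
    (mdifferentiableAt_of_isLightlike hf x).hasMFDerivAt).congr_of_eventuallyEq hcongr
  rw [mvfderiv, h3.mfderiv]
  exact h1

end InducedConnection

/-! ### The form `g + η ⊗ η` -/

section Pointwise

variable {n : ℕ}
  {M : Type*} [TopologicalSpace M] [ChartedSpace (EuclideanSpace ℝ (Fin (n + 1))) M]
  [IsManifold (𝓡 (n + 1)) ∞ M]
  {N : Type*} [TopologicalSpace N] [ChartedSpace (EuclideanSpace ℝ (Fin (n + 2))) N]
  [IsManifold (𝓡 (n + 2)) ∞ N]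
  {gb : LorentzianMetric (n + 2) N}
  {f : M → N} {sc : ∀ x : M, Submodule ℝ (TangentSpace (𝓡 (n + 1)) x)}
  {ξ : Π x : M, TangentSpace (𝓡 (n + 1)) x} {ν : Π x : M, TangentSpace (𝓡 (n + 2)) (f x)}

/-- The induced metric as a bilinear form. -/
noncomputable def indForm (gb : LorentzianMetric (n + 2) N) (f : M → N) (x : M) :
    TangentSpace (𝓡 (n + 1)) x →ₗ[ℝ] TangentSpace (𝓡 (n + 1)) x →ₗ[ℝ] ℝ :=
  LinearMap.mk₂ ℝ (indMetric gb f x) (by simp [indMetric]) (by simp [indMetric])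
    (by simp [indMetric]) (by simp [indMetric])

/-- The one-form `η` as a linear form. -/
noncomputable def etaForm (gb : LorentzianMetric (n + 2) N) (f : M → N)
    (ν : Π x : M, TangentSpace (𝓡 (n + 2)) (f x)) (x : M) :
    TangentSpace (𝓡 (n + 1)) x →ₗ[ℝ] ℝ :=
  ((gb.val (f x) (ν x)) ∘L push f x).toLinearMap

lemma indForm_apply (x : M) (v w : TangentSpace (𝓡 (n + 1)) x) :
    indForm gb f x v w = indMetric gb f x v w := rfl

lemma etaForm_apply (x : M) (v : TangentSpace (𝓡 (n + 1)) x) :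
    etaForm gb f ν x v = eta gb f ν x v := rfl

lemma indForm_symm (x : M) (v w : TangentSpace (𝓡 (n + 1)) x) :
    indForm gb f x v w = indForm gb f x w v := gb.symm _ _ _

lemma mem_radical_iff {x : M} {v : TangentSpace (𝓡 (n + 1)) x} :
    v ∈ radical gb f x ↔ ∀ w, indForm gb f x v w = 0 := Iff.rfl

lemma indForm_eq_zero_of_mem_radical {x : M} {v : TangentSpace (𝓡 (n + 1)) x}
    (hv : v ∈ radical gb f x) (w : TangentSpace (𝓡 (n + 1)) x) : indForm gb f x w v = 0 := by
  rw [indForm_symm]; exact mem_radical_iff.1 hv w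

/-- The induced metric is positive semidefinite, since every tangent vector of the hypersurface is
orthogonal to the null vector `ξ`. -/
lemma indForm_self_nonneg (hξ : IsNullSection gb f ξ) (hν : IsNullTransversal gb f sc ξ ν)
    (x : M) (v : TangentSpace (𝓡 (n + 1)) x) : 0 ≤ indForm gb f x v v := by
  obtain ⟨b, hb⟩ := gb.lorentzian (f x)
  let B : TangentSpace (𝓡 (n + 2)) (f x) →ₗ[ℝ] TangentSpace (𝓡 (n + 2)) (f x) →ₗ[ℝ] ℝ :=
    LinearMap.mk₂ ℝ (fun v w ↦ gb.val (f x) v w) (by simp) (by simp) (by simp) (by simp)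
  refine nonneg_of_orthogonal_null B b hb (e := push f x (ξ x)) (w := push f x v) ?_
    (hξ.mem_radical x _) (hξ.mem_radical x _)
  intro h0
  have := hν.inner_xi x
  simp [h0] at this

lemma eq_eta_smul_of_mem_radical (hf : IsLightlikeHypersurface gb f) (hξ : IsNullSection gb f ξ)
    (hν : IsNullTransversal gb f sc ξ ν) {x : M} {v : TangentSpace (𝓡 (n + 1)) x}
    (hv : v ∈ radical gb f x) : v = etaForm gb f ν x v • ξ x := by
  obtain ⟨c, hc⟩ := exists_smul_eq_of_finrank_eq_one (hf.rank_radical x)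
    (x := ⟨ξ x, hξ.mem_radical x⟩) (by simpa [Subtype.ext_iff] using hξ.ne_zero x) ⟨v, hv⟩
  have hc' : c • ξ x = v := congrArg Subtype.val hc
  have h1 : etaForm gb f ν x (ξ x) = 1 := hν.inner_xi x
  rw [← hc', map_smul, h1, smul_eq_mul, mul_one]

/-- The associated metric `g + η ⊗ η` is positive definite. -/
lemma indForm_add_eta_pos (hf : IsLightlikeHypersurface gb f) (hξ : IsNullSection gb f ξ)
    (hν : IsNullTransversal gb f sc ξ ν) {x : M} {v : TangentSpace (𝓡 (n + 1)) x} (hv : v ≠ 0) :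
    0 < indForm gb f x v v + etaForm gb f ν x v * etaForm gb f ν x v := by
  have h1 := indForm_self_nonneg hξ hν x v
  have h2 := mul_self_nonneg (etaForm gb f ν x v)
  rcases (add_nonneg h1 h2).lt_or_eq with h | h
  · exact h
  · exfalso
    have h3 : indForm gb f x v v = 0 := by linarith
    have h4 : etaForm gb f ν x v = 0 := mul_self_eq_zero.1 (by linarith)
    have h5 : v ∈ radical gb f x := mem_radical_iff.2
      (apply_eq_zero_of_nonneg _ (indForm_symm x) (indForm_self_nonneg hξ hν x) h3)
    apply hv
    rw [eq_eta_smul_of_mem_radical hf hξ hν h5, h4, zero_smul]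

end Pointwise

/-! ### Smooth fields of endomorphisms and tensoriality -/

section Fields

variable {m k : ℕ} {M : Type*} [TopologicalSpace M] [ChartedSpace (EuclideanSpace ℝ (Fin m)) M]
  [IsManifold (𝓡 m) ∞ M] {x : M} {U : Set M}
  {S : ∀ x : M, TangentSpace (𝓡 m) x →L[ℝ] TangentSpace (𝓡 m) x}
  {X Y : Π y : M, TangentSpace (𝓡 m) y} {l : Fin (k + 1) → M → ℝ}

lemma SmoothFieldOn.diffFieldAt (hX : SmoothFieldOn X U) (hU : IsOpen U) (hx : x ∈ U) :
    DiffFieldAt X x :=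
  (ContMDiffOn.contMDiffAt hX (hU.mem_nhds hx)).mdifferentiableAt (by simp)

lemma DiffFieldAt.add (hX : DiffFieldAt X x) (hY : DiffFieldAt Y x) : DiffFieldAt (X + Y) x :=
  mdifferentiableAt_add_section hX hY

lemma DiffFieldAt.sub (hX : DiffFieldAt X x) (hY : DiffFieldAt Y x) : DiffFieldAt (X - Y) x :=
  mdifferentiableAt_sub_section hX hY

lemma DiffFieldAt.smul {c : M → ℝ} (hc : MDifferentiableAt (𝓡 m) 𝓘(ℝ, ℝ) c x)
    (hX : DiffFieldAt X x) : DiffFieldAt (c • X) x :=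
  MDifferentiableAt.smul_section hc hX

/-- The endomorphism field `S` is smooth. -/
def SmoothEnd (S : ∀ x : M, TangentSpace (𝓡 m) x →L[ℝ] TangentSpace (𝓡 m) x) : Prop :=
  ContMDiff (𝓡 m)
    ((𝓡 m).prod 𝓘(ℝ, EuclideanSpace ℝ (Fin m) →L[ℝ] EuclideanSpace ℝ (Fin m))) ∞
    (fun x : M ↦ Bundle.TotalSpace.mk'
      (EuclideanSpace ℝ (Fin m) →L[ℝ] EuclideanSpace ℝ (Fin m))
      (E := fun x : M ↦ TangentSpace (𝓡 m) x →L[ℝ] TangentSpace (𝓡 m) x) x (S x))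

lemma SmoothEnd.smoothFieldOn (hS : SmoothEnd S) (hX : SmoothFieldOn X U) :
    SmoothFieldOn (fun y ↦ S y (X y)) U :=
  ContMDiffOn.clm_bundle_apply (b := fun y : M ↦ y) (ContMDiff.contMDiffOn hS) hX

lemma SmoothEnd.diffFieldAt (hS : SmoothEnd S) (hX : DiffFieldAt X x) :
    DiffFieldAt (fun y ↦ S y (X y)) x :=
  MDifferentiableAt.clm_bundle_apply (b := fun y : M ↦ y)
    ((ContMDiff.contMDiffAt hS).mdifferentiableAt (by simp)) hX

/-- The eigenprojections preserve every class of vector fields which is stable under the linear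
factors `(l j - l i)⁻¹ (S - l i)` of their defining polynomials. -/
lemma eigenProj_induction {C : (Π y : M, TangentSpace (𝓡 m) y) → Prop}
    (hC : ∀ i j, i ≠ j → ∀ X, C X →
      C (fun y ↦ (l j y - l i y)⁻¹ • (S y (X y) - l i y • X y)))
    (j : Fin (k + 1)) (hX : C X) :
    C (fun y ↦ eigenProj (S y).toLinearMap (fun α ↦ l α y) j (X y)) := by
  have key : ∀ s : Finset (Fin (k + 1)), j ∉ s →
      C (fun y ↦ Polynomial.aeval (S y).toLinearMap
        (∏ i ∈ s, Lagrange.basisDivisor (l j y) (l i y)) (X y)) := by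
    intro s
    induction s using Finset.induction_on with
    | empty => intro _; simpa using hX
    | insert i s hi ih =>
      intro hj
      rw [Finset.mem_insert, not_or] at hj
      have h1 := hC i j (Ne.symm hj.1) _ (ih hj.2)
      convert h1 using 2 with y
      rw [Finset.prod_insert hi, map_mul]
      simp [Lagrange.basisDivisor, Module.End.mul_apply, Module.algebraMap_end_apply]
  exact key (Finset.univ.erase j) (by simp)

lemma smoothFieldOn_eigenProj (hS : SmoothEnd S) (hl : ∀ α, ContMDiff (𝓡 m) 𝓘(ℝ, ℝ) ∞ (l α))
    (hd : ∀ y, Function.Injective fun α ↦ l α y) (hX : SmoothFieldOn X U) (j : Fin (k + 1)) :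
    SmoothFieldOn (fun y ↦ eigenProj (S y).toLinearMap (fun α ↦ l α y) j (X y)) U := by
  refine eigenProj_induction (C := fun X ↦ SmoothFieldOn X U) (fun i j hij Y hY ↦ ?_) j hX
  have h1 : ContMDiff (𝓡 m) 𝓘(ℝ, ℝ) ∞ (fun y ↦ (l j y - l i y)⁻¹) :=
    ((hl j).sub (hl i)).inv₀ fun y ↦ sub_ne_zero.2 fun h ↦ hij (hd y h).symm
  have h2 : SmoothFieldOn (fun y ↦ l i y • Y y) U :=
    ContMDiffOn.smul_section (hl i).contMDiffOn hY
  have h3 : SmoothFieldOn (fun y ↦ S y (Y y) - l i y • Y y) U :=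
    ContMDiffOn.sub_section (hS.smoothFieldOn hY) h2
  exact ContMDiffOn.smul_section h1.contMDiffOn h3

lemma diffFieldAt_eigenProj (hS : SmoothEnd S) (hl : ∀ α, ContMDiff (𝓡 m) 𝓘(ℝ, ℝ) ∞ (l α))
    (hd : ∀ y, Function.Injective fun α ↦ l α y) (hX : DiffFieldAt X x) (j : Fin (k + 1)) :
    DiffFieldAt (fun y ↦ eigenProj (S y).toLinearMap (fun α ↦ l α y) j (X y)) x := by
  refine eigenProj_induction (C := fun X ↦ DiffFieldAt X x) (fun i j hij Y hY ↦ ?_) j hX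
  have h1 : ContMDiff (𝓡 m) 𝓘(ℝ, ℝ) ∞ (fun y ↦ (l j y - l i y)⁻¹) :=
    ((hl j).sub (hl i)).inv₀ fun y ↦ sub_ne_zero.2 fun h ↦ hij (hd y h).symm
  have h2 : DiffFieldAt (fun y ↦ l i y • Y y) x :=
    hY.smul ((hl i).contMDiffAt.mdifferentiableAt (by simp))
  exact ((hS.diffFieldAt hY).sub h2).smul (h1.contMDiffAt.mdifferentiableAt (by simp))

lemma exists_smoothFieldOn (x : M) (v : TangentSpace (𝓡 m) x) :
    ∃ (U : Set M) (X : Π y : M, TangentSpace (𝓡 m) y),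
      IsOpen U ∧ x ∈ U ∧ SmoothFieldOn X U ∧ X x = v := by
  obtain ⟨s, hs, hX⟩ := FiberBundle.exists_contMDiffOn_extend (k := ∞) (𝓡 m)
    (EuclideanSpace ℝ (Fin m)) (V := (TangentSpace (𝓡 m) : M → Type _)) v
  obtain ⟨U, hUs, hU, hxU⟩ := mem_nhds_iff.1 hs
  exact ⟨U, FiberBundle.extend (EuclideanSpace ℝ (Fin m)) v, hU, hxU, hX.mono hUs, by simp⟩

variable {D : CovariantDerivative (𝓡 m) (EuclideanSpace ℝ (Fin m))
  (TangentSpace (𝓡 m) : M → Type _)}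

lemma cov_add_apply (hX : DiffFieldAt X x) (hY : DiffFieldAt Y x) (v : TangentSpace (𝓡 m) x) :
    D (X + Y) x v = D X x v + D Y x v := by
  rw [D.isCovariantDerivativeOnUniv.add hX hY]; rfl

lemma cov_smul_apply {c : M → ℝ} (hc : MDifferentiableAt (𝓡 m) 𝓘(ℝ, ℝ) c x)
    (hX : DiffFieldAt X x) (v : TangentSpace (𝓡 m) x) :
    D (c • X) x v = c x • D X x v + mvfderiv (𝓡 m) c x v • X x := by
  rw [D.isCovariantDerivativeOnUniv.leibniz hX hc]; rfl

/-- The value of `∇S (v, Y)` depends on `Y` only through its value at the point. -/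
lemma tensorialAt_covEnd (hS : SmoothEnd S) (v : TangentSpace (𝓡 m) x) :
    TensorialAt (𝓡 m) (EuclideanSpace ℝ (Fin m)) (fun Y ↦ covEnd D S x v Y) x where
  smul {c Y} hc hY := by
    have h1 : (fun y ↦ S y ((c • Y) y)) = c • fun y ↦ S y (Y y) := by
      ext1 y; simp
    simp only [covEnd]
    rw [h1, cov_smul_apply hc (hS.diffFieldAt hY), cov_smul_apply hc hY, map_add, map_smul,
      map_smul]
    module
  add {Y Z} hY hZ := by
    have h1 : (fun y ↦ S y ((Y + Z) y)) = (fun y ↦ S y (Y y)) + fun y ↦ S y (Z y) := by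
      ext1 y; simp
    simp only [covEnd]
    rw [h1, cov_add_apply (hS.diffFieldAt hY) (hS.diffFieldAt hZ), cov_add_apply hY hZ, map_add]
    abel

end Fields

/-! ### Tensors with integrable eigendistributions -/

section Main

variable {n k : ℕ}
  {M : Type*} [TopologicalSpace M] [ChartedSpace (EuclideanSpace ℝ (Fin (n + 1))) M]
  [IsManifold (𝓡 (n + 1)) ∞ M]
  {N : Type*} [TopologicalSpace N] [ChartedSpace (EuclideanSpace ℝ (Fin (n + 2))) N]
  [IsManifold (𝓡 (n + 2)) ∞ N]
  {gb : LorentzianMetric (n + 2) N}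
  {Db : CovariantDerivative (𝓡 (n + 2)) (EuclideanSpace ℝ (Fin (n + 2)))
      (TangentSpace (𝓡 (n + 2)) : N → Type _)}
  {f : M → N} {sc : ∀ x : M, Submodule ℝ (TangentSpace (𝓡 (n + 1)) x)}
  {ξ : Π x : M, TangentSpace (𝓡 (n + 1)) x} {ν : Π x : M, TangentSpace (𝓡 (n + 2)) (f x)}
  {D : CovariantDerivative (𝓡 (n + 1)) (EuclideanSpace ℝ (Fin (n + 1)))
      (TangentSpace (𝓡 (n + 1)) : M → Type _)}
  {S : ∀ x : M, TangentSpace (𝓡 (n + 1)) x →L[ℝ] TangentSpace (𝓡 (n + 1)) x}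
  {l : Fin (k + 1) → M → ℝ}

/-- A totally geodesic lightlike hypersurface with an `A^∇`-tensor `S` whose eigenfunctions are
constant along the screen and whose eigendistributions form an integrable almost product
structure. -/
structure IsIntegrableANabla (gb : LorentzianMetric (n + 2) N)
    (Db : CovariantDerivative (𝓡 (n + 2)) (EuclideanSpace ℝ (Fin (n + 2)))
      (TangentSpace (𝓡 (n + 2)) : N → Type _))
    (f : M → N) (sc : ∀ x : M, Submodule ℝ (TangentSpace (𝓡 (n + 1)) x))
    (ξ : Π x : M, TangentSpace (𝓡 (n + 1)) x) (ν : Π x : M, TangentSpace (𝓡 (n + 2)) (f x))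
    (D : CovariantDerivative (𝓡 (n + 1)) (EuclideanSpace ℝ (Fin (n + 1)))
      (TangentSpace (𝓡 (n + 1)) : M → Type _))
    (S : ∀ x : M, TangentSpace (𝓡 (n + 1)) x →L[ℝ] TangentSpace (𝓡 (n + 1)) x)
    (l : Fin (k + 1) → M → ℝ) : Prop where
  leviCivita : IsLeviCivita gb Db
  lightlike : IsLightlikeHypersurface gb f
  totallyGeodesic : IsTotallyGeodesic Db f
  screen : IsScreen gb f sc
  nullSection : IsNullSection gb f ξ
  nullTransversal : IsNullTransversal gb f sc ξ ν
  induced : IsInducedConnection Db f ν D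
  tensor : IsANablaTensor gb f ξ ν D S
  eigenfunctions : IsEigenfunctions gb f S l
  deriv_eq_zero : ∀ (α : Fin (k + 1)) (x : M), ∀ v ∈ sc x, mvfderiv (𝓡 (n + 1)) (l α) x v = 0
  integrable : IsIntegrableAlmostProduct fun α ↦ eigenDist S (l α)

lemma mem_eigenDist_iff {h : M → ℝ} {x : M} {v : TangentSpace (𝓡 (n + 1)) x} :
    v ∈ eigenDist S h x ↔ S x v = h x • v :=
  Module.End.mem_eigenspace_iff

namespace IsIntegrableANabla

variable {x : M} {i j p : Fin (k + 1)}

/-! ### Pointwise algebra -/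

lemma eta_xi (h : IsIntegrableANabla gb Db f sc ξ ν D S l)
    (x : M) : etaForm gb f ν x (ξ x) = 1 := h.nullTransversal.inner_xi x

lemma eta_screen (h : IsIntegrableANabla gb Db f sc ξ ν D S l)
    {v : TangentSpace (𝓡 (n + 1)) x} (hv : v ∈ sc x) : etaForm gb f ν x v = 0 :=
  h.nullTransversal.inner_screen x v hv

lemma eq_eta_smul (h : IsIntegrableANabla gb Db f sc ξ ν D S l)
    {v : TangentSpace (𝓡 (n + 1)) x} (hv : v ∈ radical gb f x) :
    v = etaForm gb f ν x v • ξ x :=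
  eq_eta_smul_of_mem_radical h.lightlike h.nullSection h.nullTransversal hv

lemma mem_radical_of_mem_eigenDist (h : IsIntegrableANabla gb Db f sc ξ ν D S l)
    {v : TangentSpace (𝓡 (n + 1)) x}
    (hv : v ∈ eigenDist S (l 0) x) : v ∈ radical gb f x :=
  h.eigenfunctions.eigenDist_zero x ▸ hv

/-- The operator acts on the `ξ`-component by the eigenvalue of the radical, since it commutes with
the projection onto the screen. -/
lemma eta_apply (h : IsIntegrableANabla gb Db f sc ξ ν D S l) (v : TangentSpace (𝓡 (n + 1)) x) :
    etaForm gb f ν x (S x v) = l 0 x * etaForm gb f ν x v := by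
  have h1 : S x (ξ x) = l 0 x • ξ x := by
    rw [← mem_eigenDist_iff, h.eigenfunctions.eigenDist_zero]
    exact h.nullSection.mem_radical x
  have h2 := h.tensor.screen_preserving x v
  simp only [screenProj, map_sub, map_smul, h1, sub_right_inj] at h2
  have h3 := congrArg (etaForm gb f ν x) h2
  simp only [map_smul, h.eta_xi, smul_eq_mul, mul_one] at h3
  rw [mul_comm]
  exact h3.symm

lemma injective (h : IsIntegrableANabla gb Db f sc ξ ν D S l)
    (x : M) : Function.Injective fun α ↦ l α x := h.eigenfunctions.distinct x

lemma sub_ne_zero (h : IsIntegrableANabla gb Db f sc ξ ν D S l) (hij : i ≠ j) : l i x - l j x ≠ 0 :=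
  _root_.sub_ne_zero.2 fun he ↦ hij (h.injective x he)

lemma eta_eq_zero (h : IsIntegrableANabla gb Db f sc ξ ν D S l)
    (hj : j ≠ 0) {v : TangentSpace (𝓡 (n + 1)) x} (hv : v ∈ eigenDist S (l j) x) :
    etaForm gb f ν x v = 0 := by
  have h1 := h.eta_apply v
  rw [mem_eigenDist_iff.1 hv, map_smul, smul_eq_mul] at h1
  have h2 : (l j x - l 0 x) * etaForm gb f ν x v = 0 := by linarith
  exact (mul_eq_zero.1 h2).resolve_left (h.sub_ne_zero hj)

lemma inner_eq_zero (h : IsIntegrableANabla gb Db f sc ξ ν D S l)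
    (hij : i ≠ j) {v w : TangentSpace (𝓡 (n + 1)) x}
    (hv : v ∈ eigenDist S (l i) x) (hw : w ∈ eigenDist S (l j) x) : indForm gb f x v w = 0 := by
  have h1 : indForm gb f x (S x v) w = indForm gb f x v (S x w) := h.tensor.symmetric x v w
  rw [mem_eigenDist_iff.1 hv, mem_eigenDist_iff.1 hw, map_smul, map_smul, LinearMap.smul_apply,
    smul_eq_mul, smul_eq_mul] at h1
  have h2 : (l i x - l j x) * indForm gb f x v w = 0 := by linarith
  exact (mul_eq_zero.1 h2).resolve_left (h.sub_ne_zero hij)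

/-- The operator is symmetric for the positive definite form `g + η ⊗ η`, hence diagonalizable. -/
lemma iSup_eigenDist (h : IsIntegrableANabla gb Db f sc ξ ν D S l)
    (x : M) : ⨆ α, Module.End.eigenspace (S x).toLinearMap (l α x) = ⊤ := by
  have : FiniteDimensional ℝ (TangentSpace (𝓡 (n + 1)) x) :=
    inferInstanceAs (FiniteDimensional ℝ (EuclideanSpace ℝ (Fin (n + 1))))
  let B : TangentSpace (𝓡 (n + 1)) x →ₗ[ℝ] TangentSpace (𝓡 (n + 1)) x →ₗ[ℝ] ℝ :=
    indForm gb f x + (etaForm gb f ν x).smulRight (etaForm gb f ν x)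
  have hB : ∀ v w, B v w = indForm gb f x v w + etaForm gb f ν x v * etaForm gb f ν x w :=
    fun v w ↦ by simp [B]
  have h1 : ⨆ μ : ℝ, Module.End.eigenspace (S x).toLinearMap μ = ⊤ := by
    refine iSup_eigenspace_eq_top_of_symmetric B (fun v w ↦ ?_) (fun v hv ↦ ?_) _ fun v w ↦ ?_
    · rw [hB, hB, indForm_symm, mul_comm]
    · rw [hB]
      exact indForm_add_eta_pos h.lightlike h.nullSection h.nullTransversal hv
    · have h2 : indForm gb f x (S x v) w = indForm gb f x v (S x w) := h.tensor.symmetric x v w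
      rw [hB, hB]
      simp only [ContinuousLinearMap.coe_coe, h2, h.eta_apply]
      ring
  rw [eq_top_iff, ← h1]
  refine iSup_le fun μ ↦ ?_
  by_cases hμ : Module.End.HasEigenvalue (S x).toLinearMap μ
  · obtain ⟨α, rfl⟩ := (h.eigenfunctions.hasEigenvalue_iff x μ).1 hμ
    exact le_iSup (fun α ↦ Module.End.eigenspace (S x).toLinearMap (l α x)) α
  · have hbot : Module.End.eigenspace (S x).toLinearMap μ = ⊥ := not_not.1 fun hne ↦ hμ hne
    exact hbot.le.trans bot_le

/-- The component of `v` in the eigenspace of `S` for `l j`. -/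
noncomputable def proj (_h : IsIntegrableANabla gb Db f sc ξ ν D S l) (j : Fin (k + 1)) (x : M) :
    TangentSpace (𝓡 (n + 1)) x →ₗ[ℝ] TangentSpace (𝓡 (n + 1)) x :=
  eigenProj (S x).toLinearMap (fun α ↦ l α x) j

lemma proj_mem (h : IsIntegrableANabla gb Db f sc ξ ν D S l)
    (j : Fin (k + 1)) (v : TangentSpace (𝓡 (n + 1)) x) :
    h.proj j x v ∈ eigenDist S (l j) x :=
  eigenProj_mem (h.injective x) (h.iSup_eigenDist x) j v

lemma sum_proj (h : IsIntegrableANabla gb Db f sc ξ ν D S l)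
    (v : TangentSpace (𝓡 (n + 1)) x) : ∑ j, h.proj j x v = v :=
  sum_eigenProj (h.injective x) v

lemma proj_self (h : IsIntegrableANabla gb Db f sc ξ ν D S l)
    {v : TangentSpace (𝓡 (n + 1)) x} (hv : v ∈ eigenDist S (l j) x) :
    h.proj j x v = v := by
  have h1 := eigenProj_of_mem (l := fun α ↦ l α x) (h.injective x) hv j
  rwa [if_pos rfl] at h1

/-- The eigenprojection onto the radical is `η ⊗ ξ`; in particular `P = 1 - η ⊗ ξ` is a polynomial
in `S` with smooth coefficients. -/
lemma proj_zero (h : IsIntegrableANabla gb Db f sc ξ ν D S l) (v : TangentSpace (𝓡 (n + 1)) x) :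
    h.proj 0 x v = etaForm gb f ν x v • ξ x := by
  rw [h.eq_eta_smul (h.mem_radical_of_mem_eigenDist (h.proj_mem 0 v))]
  congr 1
  conv_rhs => rw [← h.sum_proj v, map_sum]
  rw [Finset.sum_eq_single 0 (fun j _ hj ↦ h.eta_eq_zero hj (h.proj_mem j v)) (by simp)]

lemma screenProj_eq (h : IsIntegrableANabla gb Db f sc ξ ν D S l) (v : TangentSpace (𝓡 (n + 1)) x) :
    screenProj gb f ξ ν x v = v - h.proj 0 x v := by
  rw [h.proj_zero]; rfl

lemma screenProj_self (h : IsIntegrableANabla gb Db f sc ξ ν D S l)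
    (hj : j ≠ 0) {v : TangentSpace (𝓡 (n + 1)) x}
    (hv : v ∈ eigenDist S (l j) x) : screenProj gb f ξ ν x v = v := by
  rw [h.screenProj_eq, h.proj_zero, h.eta_eq_zero hj hv, zero_smul, sub_zero]

/-! ### Eigensections -/

lemma smoothEnd (h : IsIntegrableANabla gb Db f sc ξ ν D S l) : SmoothEnd S := h.tensor.smooth

/-- An eigenvector extends to a smooth local section, an eigenvector at every point, by applying the
smooth eigenprojection to any smooth extension. -/
lemma exists_eigenSection (h : IsIntegrableANabla gb Db f sc ξ ν D S l)
    (x : M) {v : TangentSpace (𝓡 (n + 1)) x}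
    (hv : v ∈ eigenDist S (l j) x) :
    ∃ (U : Set M) (X : Π y : M, TangentSpace (𝓡 (n + 1)) y),
      IsOpen U ∧ x ∈ U ∧ SmoothFieldOn X U ∧ (∀ y, X y ∈ eigenDist S (l j) y) ∧ X x = v := by
  obtain ⟨U, X, hU, hx, hX, hXv⟩ := exists_smoothFieldOn x v
  refine ⟨U, fun y ↦ h.proj j y (X y), hU, hx, ?_, fun y ↦ h.proj_mem j _, ?_⟩
  · exact smoothFieldOn_eigenProj h.smoothEnd h.eigenfunctions.smooth h.injective hX j
  · simp only [hXv, h.proj_self hv]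

/-- Differentiability of `P Y` comes from writing `P` as a polynomial in `S`: neither the
transversal field nor `η` is assumed smooth. -/
lemma screenProj_diffFieldAt (h : IsIntegrableANabla gb Db f sc ξ ν D S l)
    {Y : Π y : M, TangentSpace (𝓡 (n + 1)) y} (hY : DiffFieldAt Y x) :
    DiffFieldAt (fun y ↦ screenProj gb f ξ ν y (Y y)) x := by
  have h1 : (fun y ↦ screenProj gb f ξ ν y (Y y)) = Y - fun y ↦ h.proj 0 y (Y y) := by
    ext1 y; exact h.screenProj_eq (Y y)
  rw [h1]
  exact hY.sub (diffFieldAt_eigenProj h.smoothEnd h.eigenfunctions.smooth h.injective hY 0)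

/-- The form `C (v, P Y)` depends on `Y` only through its value at the point: the derivative of a
coefficient contributes a multiple of `η (P Y) = 0`. -/
lemma tensorialAt_screenForm (h : IsIntegrableANabla gb Db f sc ξ ν D S l)
    (v : TangentSpace (𝓡 (n + 1)) x) :
    TensorialAt (𝓡 (n + 1)) (EuclideanSpace ℝ (Fin (n + 1)))
      (fun Y ↦ screenForm gb f ξ ν D x v Y) x where
  smul {c Y} hc hY := by
    have h1 : (fun y ↦ screenProj gb f ξ ν y ((c • Y) y))
        = c • fun y ↦ screenProj gb f ξ ν y (Y y) := by
      ext1 y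
      simp only [h.screenProj_eq, Pi.smul_apply', map_smul, smul_sub]
    have h2 : etaForm gb f ν x (screenProj gb f ξ ν x (Y x)) = 0 := by
      rw [h.screenProj_eq, h.proj_zero, map_sub, map_smul, h.eta_xi, smul_eq_mul, mul_one, sub_self]
    simp only [screenForm]
    rw [h1, cov_smul_apply hc (h.screenProj_diffFieldAt hY), ← etaForm_apply, ← etaForm_apply,
      map_add, map_smul, map_smul, h2, smul_zero, add_zero]
  add {Y Z} hY hZ := by
    have h1 : (fun y ↦ screenProj gb f ξ ν y ((Y + Z) y))
        = (fun y ↦ screenProj gb f ξ ν y (Y y)) + fun y ↦ screenProj gb f ξ ν y (Z y) := by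
      ext1 y
      simp only [h.screenProj_eq, Pi.add_apply, map_add]
      abel
    simp only [screenForm]
    rw [h1, cov_add_apply (h.screenProj_diffFieldAt hY) (h.screenProj_diffFieldAt hZ),
      ← etaForm_apply, ← etaForm_apply, ← etaForm_apply, map_add]

/-! ### The covariant derivative of `S` on eigensections -/

variable {X Y Z : Π y : M, TangentSpace (𝓡 (n + 1)) y} {U : Set M}

/-- The eigenfunctions have no derivative along the screen, so only `∇ Y` contributes. -/
lemma covEnd_eigenSection (h : IsIntegrableANabla gb Db f sc ξ ν D S l)
    {v : TangentSpace (𝓡 (n + 1)) x} (hv : v ∈ sc x)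
    (hY : DiffFieldAt Y x) (hYj : ∀ y, Y y ∈ eigenDist S (l j) y) :
    covEnd D S x v Y = l j x • D Y x v - S x (D Y x v) := by
  have h1 : (fun y ↦ S y (Y y)) = l j • Y := by
    ext1 y; exact mem_eigenDist_iff.1 (hYj y)
  rw [covEnd, h1, cov_smul_apply
    ((h.eigenfunctions.smooth j).contMDiffAt.mdifferentiableAt (by simp)) hY,
    h.deriv_eq_zero j x v hv, zero_smul, add_zero]

lemma inner_covEnd (h : IsIntegrableANabla gb Db f sc ξ ν D S l)
    {v w : TangentSpace (𝓡 (n + 1)) x} (hv : v ∈ sc x)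
    (hY : DiffFieldAt Y x) (hYj : ∀ y, Y y ∈ eigenDist S (l j) y)
    (hw : w ∈ eigenDist S (l p) x) :
    indForm gb f x (covEnd D S x v Y) w = (l j x - l p x) * indForm gb f x (D Y x v) w := by
  have h1 : indForm gb f x (S x (D Y x v)) w = indForm gb f x (D Y x v) (S x w) :=
    h.tensor.symmetric x _ _
  rw [h.covEnd_eigenSection hv hY hYj, map_sub, LinearMap.sub_apply, h1, mem_eigenDist_iff.1 hw]
  simp only [map_smul, LinearMap.smul_apply, smul_eq_mul]
  ring

/-- Metric compatibility for two orthogonal eigensections. -/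
lemma inner_cov_swap (h : IsIntegrableANabla gb Db f sc ξ ν D S l)
    (hij : i ≠ j) (v : TangentSpace (𝓡 (n + 1)) x)
    (hX : DiffFieldAt X x) (hXi : ∀ y, X y ∈ eigenDist S (l i) y)
    (hY : DiffFieldAt Y x) (hYj : ∀ y, Y y ∈ eigenDist S (l j) y) :
    indForm gb f x (D X x v) (Y x) = -indForm gb f x (D Y x v) (X x) := by
  have h1 := induced_metric h.leviCivita h.lightlike h.totallyGeodesic h.nullSection
    h.nullTransversal h.induced v hX hY
  have h2 : (fun y ↦ indMetric gb f y (X y) (Y y)) = fun _ ↦ (0 : ℝ) := by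
    ext y; exact h.inner_eq_zero hij (hXi y) (hYj y)
  rw [h2, mvfderiv_const] at h1
  simp only [zero_apply, ← indForm_apply] at h1
  rw [indForm_symm x (D Y x v)]
  linarith

/-- Integrability of `D i ⊕ D j` makes the connection symmetric modulo `D i ⊕ D j`. -/
lemma inner_cov_comm (h : IsIntegrableANabla gb Db f sc ξ ν D S l)
    (hip : i ≠ p) (hjp : j ≠ p) (hU : IsOpen U) (hx : x ∈ U)
    (hX : SmoothFieldOn X U) (hXi : ∀ y, X y ∈ eigenDist S (l i) y)
    (hY : SmoothFieldOn Y U) (hYj : ∀ y, Y y ∈ eigenDist S (l j) y)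
    {w : TangentSpace (𝓡 (n + 1)) x} (hw : w ∈ eigenDist S (l p) x) :
    indForm gb f x (D Y x (X x)) w = indForm gb f x (D X x (Y x)) w := by
  have h1 := induced_torsion_free h.leviCivita h.lightlike h.totallyGeodesic h.nullSection
    h.nullTransversal h.induced (hX.diffFieldAt hU hx) (hY.diffFieldAt hU hx)
  have hmem : VectorField.mlieBracket (𝓡 (n + 1)) X Y x ∈
      ⨆ α ∈ ({i, j} : Finset (Fin (k + 1))), eigenDist S (l α) x :=
    h.integrable {i, j} U X Y hU hX hY
      (fun y _ ↦ Submodule.mem_iSup_of_mem i (Submodule.mem_iSup_of_mem (by simp) (hXi y)))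
      (fun y _ ↦ Submodule.mem_iSup_of_mem j (Submodule.mem_iSup_of_mem (by simp) (hYj y))) x hx
  have hle : ⨆ α ∈ ({i, j} : Finset (Fin (k + 1))), eigenDist S (l α) x ≤
      LinearMap.ker ((indForm gb f x).flip w) := by
    refine iSup₂_le fun α hα u hu ↦ ?_
    have hαp : α ≠ p := by
      rcases Finset.mem_insert.1 hα with rfl | hα
      · exact hip
      · rw [Finset.mem_singleton.1 hα]; exact hjp
    simpa using h.inner_eq_zero hαp hu hw
  have h2 : indForm gb f x (VectorField.mlieBracket (𝓡 (n + 1)) X Y x) w = 0 := by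
    simpa using hle hmem
  have h3 : gb.val (f x) (push f x (D Y x (X x)) - push f x (D X x (Y x))) (push f x w) = 0 := by
    rw [h1]; exact h2
  rw [map_sub, sub_apply] at h3
  exact _root_.sub_eq_zero.1 h3

/-- For three distinct eigenvalues the six mixed products `⟨∇_X Y, Z⟩` are equal up to signs
which force them to vanish. -/
lemma inner_cov_eq_zero (h : IsIntegrableANabla gb Db f sc ξ ν D S l)
    (hij : i ≠ j) (hip : i ≠ p) (hjp : j ≠ p) (hU : IsOpen U) (hx : x ∈ U)
    (hX : SmoothFieldOn X U) (hXi : ∀ y, X y ∈ eigenDist S (l i) y)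
    (hY : SmoothFieldOn Y U) (hYj : ∀ y, Y y ∈ eigenDist S (l j) y)
    (hZ : SmoothFieldOn Z U) (hZp : ∀ y, Z y ∈ eigenDist S (l p) y) :
    indForm gb f x (D Y x (X x)) (Z x) = 0 := by
  have dX := hX.diffFieldAt hU hx
  have dY := hY.diffFieldAt hU hx
  have dZ := hZ.diffFieldAt hU hx
  have h1 := h.inner_cov_comm hip hjp hU hx hX hXi hY hYj (hZp x)
  have h2 := h.inner_cov_swap hip (Y x) dX hXi dZ hZp
  have h3 := h.inner_cov_comm hij.symm hip.symm hU hx hY hYj hZ hZp (hXi x)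
  have h4 := h.inner_cov_swap hij.symm (Z x) dY hYj dX hXi
  have h5 := h.inner_cov_comm hjp.symm hij hU hx hZ hZp hX hXi (hYj x)
  have h6 := h.inner_cov_swap hjp.symm (X x) dZ hZp dY hYj
  linarith

/-- The defining identity of an `A^∇`-tensor, polarized in the direction of `X + Z` and
`X - Z`. The first gives `2 a + 2 b = 0` and the second `-2 a + 2 b = 0` for
`a = ⟨∇S (X, X), Z⟩` and `b = ⟨∇S (Z, Z), X⟩`. -/
lemma inner_covEnd_self_eq_zero (h : IsIntegrableANabla gb Db f sc ξ ν D S l)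
    (hip : i ≠ p) (hXsc : X x ∈ sc x) (hZsc : Z x ∈ sc x)
    (hX : DiffFieldAt X x) (hXi : ∀ y, X y ∈ eigenDist S (l i) y)
    (hZ : DiffFieldAt Z x) (hZp : ∀ y, Z y ∈ eigenDist S (l p) y) :
    indForm gb f x (covEnd D S x (X x) X) (Z x) = 0 := by
  have hflat : ∀ W : Π y : M, TangentSpace (𝓡 (n + 1)) y, DiffFieldAt W x → W x ∈ sc x →
      indForm gb f x (covEnd D S x (W x) W) (W x) = 0 := by
    intro W hW hWsc
    have h1 : indForm gb f x (W x) (covEnd D S x (W x) W) +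
        etaForm gb f ν x (W x) * etaForm gb f ν x (covEnd D S x (W x) W) = 0 :=
      h.tensor.flat_eq_zero x W hW
    rw [h.eta_screen hWsc, zero_mul, add_zero, indForm_symm] at h1
    exact h1
  have hlin : ∀ (u v : TangentSpace (𝓡 (n + 1)) x) (W : Π y : M, TangentSpace (𝓡 (n + 1)) y),
      covEnd D S x (u + v) W = covEnd D S x u W + covEnd D S x v W := by
    intro u v W
    simp only [covEnd, map_add]
    abel
  have hneg : ∀ (v : TangentSpace (𝓡 (n + 1)) x) (W : Π y : M, TangentSpace (𝓡 (n + 1)) y),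
      covEnd D S x (-v) W = -covEnd D S x v W := by
    intro v W
    simp only [covEnd, map_neg]
    abel
  have hadd : ∀ v, covEnd D S x v (X + Z) = covEnd D S x v X + covEnd D S x v Z :=
    fun v ↦ (tensorialAt_covEnd h.smoothEnd v).add hX hZ
  have hsub : ∀ v, covEnd D S x v (X - Z) = covEnd D S x v X - covEnd D S x v Z := by
    intro v
    have h1 := (tensorialAt_covEnd (D := D) h.smoothEnd v).add (hX.sub hZ) hZ
    rw [sub_add_cancel] at h1
    exact eq_sub_of_add_eq h1.symm
  have hp := hflat (X + Z) (hX.add hZ) (add_mem hXsc hZsc)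
  have hm := hflat (X - Z) (hX.sub hZ) (sub_mem hXsc hZsc)
  rw [Pi.add_apply, hadd, hlin, hlin] at hp
  rw [Pi.sub_apply, hsub, sub_eq_add_neg (X x), hlin, hlin, hneg, hneg] at hm
  simp only [map_add, map_sub, map_neg, LinearMap.add_apply, LinearMap.sub_apply,
    LinearMap.neg_apply] at hp hm
  have e1 := h.inner_covEnd hXsc hX hXi (hXi x)
  have e2 := h.inner_covEnd hZsc hX hXi (hXi x)
  have e3 := h.inner_covEnd hXsc hZ hZp (hZp x)
  have e4 := h.inner_covEnd hZsc hZ hZp (hZp x)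
  have e5 := h.inner_covEnd hXsc hZ hZp (hXi x)
  have e6 := h.inner_covEnd hXsc hX hXi (hZp x)
  have e7 := h.inner_cov_swap hip (X x) hX hXi hZ hZp
  rw [sub_self, zero_mul] at e1 e2 e3 e4
  -- symmetry of `∇S (X, ·)` with respect to the metric
  have e8 : indForm gb f x (covEnd D S x (X x) Z) (X x) =
      indForm gb f x (covEnd D S x (X x) X) (Z x) := by
    rw [e5, e6, e7]; ring
  linarith

/-- The case `X, Y ∈ D i`, `Z ∈ D p` of `⟨∇S (X, Y), Z⟩ = 0`: the expression is alternating in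
`(X, Y)` by polarization and symmetric in `(X, Y)` by integrability of `D i`. -/
lemma inner_covEnd_diagonal (h : IsIntegrableANabla gb Db f sc ξ ν D S l)
    (hip : i ≠ p) (hU : IsOpen U) (hx : x ∈ U) (hXsc : X x ∈ sc x)
    (hYsc : Y x ∈ sc x) (hZsc : Z x ∈ sc x)
    (hX : SmoothFieldOn X U) (hXi : ∀ y, X y ∈ eigenDist S (l i) y)
    (hY : SmoothFieldOn Y U) (hYi : ∀ y, Y y ∈ eigenDist S (l i) y)
    (hZ : SmoothFieldOn Z U) (hZp : ∀ y, Z y ∈ eigenDist S (l p) y) :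
    indForm gb f x (covEnd D S x (X x) Y) (Z x) = 0 := by
  have dX := hX.diffFieldAt hU hx
  have dY := hY.diffFieldAt hU hx
  have dZ := hZ.diffFieldAt hU hx
  have h1 := h.inner_covEnd_self_eq_zero hip hXsc hZsc dX hXi dZ hZp
  have h2 := h.inner_covEnd_self_eq_zero hip hYsc hZsc dY hYi dZ hZp
  have h3 := h.inner_covEnd_self_eq_zero hip (X := X + Y) (add_mem hXsc hYsc) hZsc (dX.add dY)
    (fun y ↦ add_mem (hXi y) (hYi y)) dZ hZp
  have h4 := h.inner_cov_comm hip hip hU hx hX hXi hY hYi (hZp x)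
  have h5 := h.inner_covEnd hXsc dY hYi (hZp x)
  have h6 := h.inner_covEnd hYsc dX hXi (hZp x)
  have hadd : ∀ v, covEnd D S x v (X + Y) = covEnd D S x v X + covEnd D S x v Y :=
    fun v ↦ (tensorialAt_covEnd h.smoothEnd v).add dX dY
  have hlin : ∀ W : Π y : M, TangentSpace (𝓡 (n + 1)) y,
      covEnd D S x (X x + Y x) W = covEnd D S x (X x) W + covEnd D S x (Y x) W := by
    intro W
    simp only [covEnd, map_add]
    abel
  rw [Pi.add_apply, hadd, hlin, hlin] at h3
  simp only [map_add, LinearMap.add_apply] at h3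
  rw [← h4, ← h5] at h6
  linarith

lemma mem_screen (h : IsIntegrableANabla gb Db f sc ξ ν D S l) {v : TangentSpace (𝓡 (n + 1)) x}
    (hv : etaForm gb f ν x v = 0) : v ∈ sc x := by
  obtain ⟨r, hr, s, hs, rfl⟩ := Submodule.mem_sup.1
    ((h.screen.isCompl x).sup_eq_top ▸ Submodule.mem_top (x := v))
  rw [map_add, h.eta_screen hs, add_zero] at hv
  rw [h.eq_eta_smul hr, hv, zero_smul, zero_add]
  exact hs

/-- The cubic form `⟨∇S (X, Y), Z⟩` vanishes on eigensections of the screen. -/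
lemma inner_covEnd_eq_zero (h : IsIntegrableANabla gb Db f sc ξ ν D S l)
    (hi : i ≠ 0) (hj : j ≠ 0) (hp : p ≠ 0) (hU : IsOpen U) (hx : x ∈ U)
    (hX : SmoothFieldOn X U) (hXi : ∀ y, X y ∈ eigenDist S (l i) y)
    (hY : SmoothFieldOn Y U) (hYj : ∀ y, Y y ∈ eigenDist S (l j) y)
    (hZ : SmoothFieldOn Z U) (hZp : ∀ y, Z y ∈ eigenDist S (l p) y) :
    indForm gb f x (covEnd D S x (X x) Y) (Z x) = 0 := by
  have sX := h.mem_screen (h.eta_eq_zero hi (hXi x))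
  have sY := h.mem_screen (h.eta_eq_zero hj (hYj x))
  have sZ := h.mem_screen (h.eta_eq_zero hp (hZp x))
  have dY := hY.diffFieldAt hU hx
  have dZ := hZ.diffFieldAt hU hx
  have h1 := h.inner_covEnd sX dY hYj (hZp x)
  by_cases hjp : j = p
  · rw [h1, hjp, sub_self, zero_mul]
  by_cases hij : i = j
  · subst hij
    exact h.inner_covEnd_diagonal hjp hU hx sX sY sZ hX hXi hY hYj hZ hZp
  by_cases hip : i = p
  · subst hip
    have h2 := h.inner_covEnd_diagonal hij hU hx sX sZ sY hX hXi hZ hZp hY hYj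
    rw [h.inner_covEnd sX dZ hZp (hYj x), h.inner_cov_swap hij (X x) dZ hZp dY hYj] at h2
    rw [h1]
    linarith
  · rw [h1, h.inner_cov_eq_zero hij hip hjp hU hx hX hXi hY hYj hZ hZp, mul_zero]

/-- By metric compatibility the connection preserves the radical, so `∇S` annihilates sections of
the radical in screen directions. -/
lemma covEnd_radical (h : IsIntegrableANabla gb Db f sc ξ ν D S l)
    {v : TangentSpace (𝓡 (n + 1)) x} (hv : v ∈ sc x)
    (hY : DiffFieldAt Y x) (hY0 : ∀ y, Y y ∈ eigenDist S (l 0) y) :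
    covEnd D S x v Y = 0 := by
  have h1 : D Y x v ∈ eigenDist S (l 0) x := by
    rw [h.eigenfunctions.eigenDist_zero, mem_radical_iff]
    intro w
    rw [← h.sum_proj w, map_sum]
    refine Finset.sum_eq_zero fun j _ ↦ ?_
    by_cases hj : j = 0
    · subst hj
      exact indForm_eq_zero_of_mem_radical (h.mem_radical_of_mem_eigenDist (h.proj_mem 0 w)) _
    · obtain ⟨U, Z, hU, hx, hZ, hZj, hZx⟩ := h.exists_eigenSection x (h.proj_mem j w)
      rw [← hZx, h.inner_cov_swap (Ne.symm hj) v hY hY0 (hZ.diffFieldAt hU hx) hZj,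
        indForm_eq_zero_of_mem_radical (h.mem_radical_of_mem_eigenDist (hY0 x)), neg_zero]
  rw [h.covEnd_eigenSection hv hY hY0, mem_eigenDist_iff.1 h1, sub_self]

lemma covEnd_eigenSection_mem_radical (h : IsIntegrableANabla gb Db f sc ξ ν D S l)
    {v : TangentSpace (𝓡 (n + 1)) x} (hv : v ∈ sc x) (hU : IsOpen U) (hx : x ∈ U)
    (hY : SmoothFieldOn Y U) (hYj : ∀ y, Y y ∈ eigenDist S (l j) y) :
    covEnd D S x v Y ∈ radical gb f x := by
  by_cases hj : j = 0
  · subst hj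
    rw [h.covEnd_radical hv (hY.diffFieldAt hU hx) hYj]
    exact zero_mem _
  rw [mem_radical_iff]
  intro w
  rw [← h.sum_proj w, map_sum]
  refine Finset.sum_eq_zero fun p _ ↦ ?_
  by_cases hp : p = 0
  · subst hp
    exact indForm_eq_zero_of_mem_radical (h.mem_radical_of_mem_eigenDist (h.proj_mem 0 w)) _
  have hlin : covEnd D S x v Y = ∑ i, covEnd D S x (h.proj i x v) Y := by
    conv_lhs => rw [← h.sum_proj v]
    simp only [covEnd, map_sum, Finset.sum_sub_distrib]
  rw [hlin, map_sum, LinearMap.sum_apply]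
  refine Finset.sum_eq_zero fun i _ ↦ ?_
  by_cases hi : i = 0
  · subst hi
    rw [h.proj_zero, h.eta_screen hv, zero_smul]
    simp [covEnd]
  obtain ⟨U₁, X, hU₁, hx₁, hX, hXi, hXx⟩ := h.exists_eigenSection x (h.proj_mem i v)
  obtain ⟨U₂, Z, hU₂, hx₂, hZ, hZp, hZx⟩ := h.exists_eigenSection x (h.proj_mem p w)
  rw [← hXx, ← hZx]
  exact h.inner_covEnd_eq_zero hi hj hp ((hU.inter hU₁).inter hU₂) ⟨⟨hx, hx₁⟩, hx₂⟩
    (hX.mono fun _ hy ↦ hy.1.2) hXi (hY.mono fun _ hy ↦ hy.1.1) hYj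
    (hZ.mono fun _ hy ↦ hy.2) hZp

/-- For arbitrary `Y`, replace it by a sum of eigensections with the same value at the point. -/
theorem covEnd_mem_radical (h : IsIntegrableANabla gb Db f sc ξ ν D S l)
    {v : TangentSpace (𝓡 (n + 1)) x} (hv : v ∈ sc x) (hY : DiffFieldAt Y x) :
    covEnd D S x v Y ∈ radical gb f x := by
  choose U E hU hx hE hEj hEx using fun j ↦ h.exists_eigenSection x (h.proj_mem j (Y x))
  have dE : ∀ j, DiffFieldAt (E j) x := fun j ↦ (hE j).diffFieldAt (hU j) (hx j)
  have ht := tensorialAt_covEnd (D := D) h.smoothEnd v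
  have h1 : covEnd D S x v Y = covEnd D S x v (fun y ↦ ∑ j, E j y) := by
    refine ht.pointwise hY (MDifferentiableAt.sum_section fun j _ ↦ dE j) ?_
    simp only [hEx, h.sum_proj]
  rw [h1, ht.sum E fun j _ ↦ dE j]
  exact sum_mem fun j _ ↦ h.covEnd_eigenSection_mem_radical hv (hU j) (hx j) (hE j) (hEj j)

/-- Only the `ξ`-component of `∇S (v, Y) = l j • ∇_v Y - S (∇_v Y)` survives, and
`η ∘ S = l 0 • η`. -/
theorem covEnd_eq (h : IsIntegrableANabla gb Db f sc ξ ν D S l)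
    {v : TangentSpace (𝓡 (n + 1)) x} (hv : v ∈ sc x) (hY : DiffFieldAt Y x)
    (hYj : Y x ∈ eigenDist S (l j) x) :
    covEnd D S x v Y = ((l j x - l 0 x) * screenForm gb f ξ ν D x v Y) • ξ x := by
  obtain ⟨U, E, hU, hx, hE, hEj, hEx⟩ := h.exists_eigenSection x hYj
  have dE : DiffFieldAt E x := hE.diffFieldAt hU hx
  rw [(tensorialAt_covEnd (D := D) h.smoothEnd v).pointwise hY dE hEx.symm]
  by_cases hj : j = 0
  · subst hj
    rw [h.covEnd_radical hv dE hEj, sub_self, zero_mul, zero_smul]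
  have hC : screenForm gb f ξ ν D x v Y = etaForm gb f ν x (D E x v) := by
    rw [(h.tensorialAt_screenForm v).pointwise hY dE hEx.symm, screenForm]
    simp only [h.screenProj_self hj (hEj _)]
    rfl
  rw [h.eq_eta_smul (h.covEnd_mem_radical hv dE), hC, h.covEnd_eigenSection hv dE hEj, map_sub,
    map_smul, h.eta_apply, smul_eq_mul, sub_mul]

end IsIntegrableANabla

end Main

end NullGeometry

theorem theorem7p1 {n k : ℕ}
    {M : Type*} [TopologicalSpace M] [T2Space M] [SecondCountableTopology M]
    [ChartedSpace (EuclideanSpace ℝ (Fin (n + 1))) M] [IsManifold (𝓡 (n + 1)) ∞ M]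
    {N : Type*} [TopologicalSpace N] [T2Space N] [SecondCountableTopology N]
    [ChartedSpace (EuclideanSpace ℝ (Fin (n + 2))) N] [IsManifold (𝓡 (n + 2)) ∞ N]
    (gb : LorentzianMetric (n + 2) N)
    (Db : CovariantDerivative (𝓡 (n + 2)) (EuclideanSpace ℝ (Fin (n + 2)))
      (TangentSpace (𝓡 (n + 2)) : N → Type _))
    (hDb : IsLeviCivita gb Db)
    (f : M → N) (hf : IsLightlikeHypersurface gb f) (hgeo : IsTotallyGeodesic Db f)
    (sc : ∀ x : M, Submodule ℝ (TangentSpace (𝓡 (n + 1)) x)) (hsc : IsScreen gb f sc)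
    (ξ : Π x : M, TangentSpace (𝓡 (n + 1)) x) (hξ : IsNullSection gb f ξ)
    (ν : Π x : M, TangentSpace (𝓡 (n + 2)) (f x)) (hν : IsNullTransversal gb f sc ξ ν)
    (D : CovariantDerivative (𝓡 (n + 1)) (EuclideanSpace ℝ (Fin (n + 1)))
      (TangentSpace (𝓡 (n + 1)) : M → Type _))
    (hD : IsInducedConnection Db f ν D)
    (S : ∀ x : M, TangentSpace (𝓡 (n + 1)) x →L[ℝ] TangentSpace (𝓡 (n + 1)) x)
    (hS : IsANablaTensor gb f ξ ν D S)
    (l : Fin (k + 1) → M → ℝ) (hl : IsEigenfunctions gb f S l)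
    (G : Fin (k + 1) → Π x : M, TangentSpace (𝓡 (n + 1)) x)
    (hG : ∀ α, IsGradient gb f ν (l α) (G α))
    (hGrad : ∀ α x, G α x ∈ radical gb f x)
    (hint : IsIntegrableAlmostProduct (fun α ↦ eigenDist S (l α))) :
    (∀ (x : M), ∀ v ∈ sc x, ∀ Y : Π y : M, TangentSpace (𝓡 (n + 1)) y, DiffFieldAt Y x →
      covEnd D S x v Y ∈ radical gb f x) ∧
    (∀ (x : M), ∀ v ∈ sc x, ∀ (j : Fin (k + 1)) (Y : Π y : M, TangentSpace (𝓡 (n + 1)) y),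
      DiffFieldAt Y x → Y x ∈ eigenDist S (l j) x →
      covEnd D S x v Y = ((l j x - l 0 x) * screenForm gb f ξ ν D x v Y) • ξ x) := by
  have h : IsIntegrableANabla gb Db f sc ξ ν D S l := by
    refine ⟨hDb, hf, hgeo, hsc, hξ, hν, hD, hS, hl, fun α x v hv ↦ ?_, hint⟩
    have h1 : indMetric gb f x (G α x) v = 0 := hGrad α x v
    have h2 : eta gb f ν x v = 0 := hν.inner_screen x v hv
    rw [← hG α x v, flat, h1, h2, mul_zero, add_zero]
  exact ⟨fun x v hv Y hY ↦ h.covEnd_mem_radical hv hY,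
    fun x v hv j Y hY hYj ↦ h.covEnd_eq hv hY hYj⟩
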